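/- Setting. A finite set of DAG tasks $\tau_i$ shares finitely many resources $\ell_q$. Task $\tau_i$ has a minimum separation (period) $T_i$ between consecutive job releases, a relative deadline $0<D_i\le T_i$, and a finite acyclic precedence graph whose vertices $v$ have worst-case execution times $c(v)\ge 0$. Let $\mathcal C_i=\sum_v c(v)$ and let $\mathcal L_i$ be the maximal length $\sum_{v\in\pi}c(v)$ of a path $\pi$ of this graph. Each job of $\tau_i$ accesses $\ell_q$ at most $N_{i,q}$ times, each access holding the lock of $\ell_q$ for at most $L_{i,q}$ time units (included in the execution times); $\Theta_i=\{\ell_q : N_{i,q}>0\}$. Task $\tau_i$ is scheduled by a work-conserving scheduler on $m_i\ge 1$ processors of its own. Accesses are non-nested and lie within one vertex. A vertex that requests a lock held by another vertex spins (not counted as execution), and spinning and lock holding are non-preemptive. Tasks have distinct priorities. Locks are served in priority order: no request is granted while a request of a higher-priority task is spinning for the same resource. Requests of the same task are served among each other either in arbitrary order or in FIFO order. Let $\tau_i^H$ and $\tau_i^L$ be the sets of tasks with higher and lower priority than $\tau_i$. The response time of a job is its finish time minus its release time, and $R_i$ is the supremum of the response times of the jobs of $\tau_i$ in the run considered. Notation.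 Maxima over the empty set are $0$. If both $\tau_i$ and $\tau_j$ access $\ell_q$, put \[\eta_{i,j}^q=\left\lceil\frac{D_i+D_j}{T_j}\right\rceil,\qquad \varDelta_{i,j}^q=\left\lceil\frac{dpr(\tau_i,\ell_q)+D_j}{T_j}\right\rceil ,\] and otherwise $\eta_{i,j}^q=\varDelta_{i,j}^q=0$. Here the delay-per-request $dpr(\tau_i,\ell_q)$ is the least $d\ge 0$ with \[ d=\max_{\tau_j\in\tau_i^L}L_{j,q}+\sum_{\tau_j\in\tau_i^H}\left\lceil\frac{d+D_j}{T_j}\right\rceil N_{j,q}L_{j,q}+\kappa_{i,q}L_{i,q},\] with $\kappa_{i,q}=\min\{m_i,N_{i,q}\}-1$ if requests of one task are served in FIFO order and $\kappa_{i,q}=N_{i,q}-1$ if their order is arbitrary; if there is no such $d$, then $dpr(\tau_i,\ell_q)=\varDelta_{i,j}^q=\infty$. For an integer $x\in[0,N_{i,q}]$ let \[\mathcal P^I(x)=\bigl((N_{i,q}-x)(m_i-1)-\max\{1-x,0\}\Delta\bigr)L_{i,q},\qquad \Delta=\min\{N_{i,q},m_i\}\Bigl(m_i-\tfrac{\min\{N_{i,q},m_i\}+1}{2}\Bigr),\]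 \[\mathcal P^O_L(x)=\bigl(N_{i,q}+(m_i-1)x\bigr)\max_{\tau_j\in\tau_i^L}L_{j,q},\] \[\mathcal P^O_H(x)=\sum_{\tau_j\in\tau_i^H}\min\bigl\{m_i\eta_{i,j}^qN_{j,q},\ (N_{i,q}+(m_i-1)x)\varDelta_{i,j}^qN_{j,q}\bigr\}L_{j,q},\] $\mathcal P^O(x)=\mathcal P^O_L(x)+\mathcal P^O_H(x)$ (all depending on $i$ and $q$), and \[ R_i'=\frac{\mathcal C_i+(m_i-1)\mathcal L_i+\sum_{\ell_q\in\Theta_i}\max_{x\in[0,N_{i,q}]}\{\mathcal P^I(x)+\mathcal P^O(x)\}}{m_i}.\] Theorem. Consider a run of the system with priority-ordered spin locks such that, for every task $\tau_k$, all jobs of $\tau_k$ meet their deadlines ($R_k\le D_k$) or $R_k'\le D_k$. Then $R_i\le R_i'$ for every task $\tau_i$. -/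

import Mathlib

open scoped NNReal ENNReal

noncomputable section

/-- A piece of the code of a vertex: ordinary code (`res = none`), or one access to a resource
`q` executed while holding the lock of `q` (`res = some q`); `len` is its execution time. -/
structure Segment (ρ : Type*) where
  res : Option ρ
  len : ℝ

namespace Segment

variable {ρ : Type*}

/-- Execution time of a program (a list of consecutive segments), without spinning. -/
def total (l : List (Segment ρ)) : ℝ := (l.map Segment.len).sum

/-- The segment in which a program stands after having executed for `w` time units. -/
def current : List (Segment ρ) → ℝ → Option (Segment ρ)
  | [], _ => none
  | s :: l, w => if w < s.len then some s else current l (w - s.len)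

/-- The amount of execution after which the segment that is current at `w` is completed. -/
def currentEnd : List (Segment ρ) → ℝ → ℝ
  | [], _ => 0
  | s :: l, w => if w < s.len then s.len else s.len + currentEnd l (w - s.len)

open Classical in
/-- Number of accesses to `q` in a program. -/
def accesses (l : List (Segment ρ)) (q : ρ) : ℕ :=
  l.countP fun s => decide (s.res = some q)

end Segment

/-- A set of DAG tasks (indexed by `ι`) with constrained deadlines, sharing resources (indexed
by `ρ`), where task `i` has `m i` dedicated processors. A larger `prio` is a higher priority. -/
structure TaskSystem (ι ρ : Type*) where
  V : ι → Type*
  fintypeV : ∀ i, Fintype (V i)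
  E : ∀ i, V i → V i → Prop
  acyclic : ∀ i v, ¬ Relation.TransGen (E i) v v
  /-- worst-case execution time of a vertex, resource accesses included, spinning excluded -/
  c : ∀ i, V i → ℝ≥0
  T : ι → ℝ
  D : ι → ℝ
  D_pos : ∀ i, 0 < D i
  D_le_T : ∀ i, D i ≤ T i
  m : ι → ℕ
  m_pos : ∀ i, 0 < m i
  /-- worst-case number of accesses to a resource by one job of the task -/
  N : ι → ρ → ℕ
  /-- worst-case duration of one access to a resource by the task -/
  L : ι → ρ → ℝ≥0
  prio : ι → ℕ
  prio_injective : Function.Injective prio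

attribute [instance] TaskSystem.fintypeV

/-- How requests of equal priority, i.e. of the same task, are ordered among each other. -/
inductive TieBreak
  | arbitrary
  | fifo

namespace TaskSystem

variable {ι ρ : Type*} (S : TaskSystem ι ρ)

/-! ### Runs of the system -/

/-- Vertex instances: vertex `v` of the `k`-th job of task `i` is `⟨i, (k, v)⟩`. -/
abbrev Inst : Type _ := Σ i : ι, ℕ × S.V i

/-- The data of a run of the system over the time axis `ℝ`. -/
structure Run where
  /-- release time of the `k`-th job of task `i` -/
  release : ι → ℕ → ℝ
  /-- the code that a vertex instance actually executes -/
  prog : S.Inst → List (Segment ρ)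
  /-- the vertex instance with which a processor of task `i` is busy (`none`: idle) -/
  sched : ∀ i, Fin (S.m i) → ℝ → Option (ℕ × S.V i)
  /-- the vertex instance holding the lock of a resource -/
  holder : ρ → ℝ → Option S.Inst
  /-- the amount of its code that a vertex instance has executed before a time point -/
  work : S.Inst → ℝ → ℝ

namespace Run

variable {S} (σ : S.Run)

/-- Some processor is busy with `x` (executing it or spinning on its behalf). -/
def OnProc (x : S.Inst) (t : ℝ) : Prop := ∃ p, σ.sched x.1 p t = some x.2

/-- The next piece of code of `x` is (the rest of) an access to `q`. -/
def AtAccess (x : S.Inst) (q : ρ) (t : ℝ) : Prop :=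
  ∃ s, Segment.current (σ.prog x) (σ.work x t) = some s ∧ s.res = some q

/-- `x` spins for the lock of `q`. -/
def Spinning (x : S.Inst) (q : ρ) (t : ℝ) : Prop :=
  σ.OnProc x t ∧ σ.AtAccess x q t ∧ σ.holder q t ≠ some x

/-- `x` executes, with or without holding a lock. -/
def Executing (x : S.Inst) (t : ℝ) : Prop :=
  σ.OnProc x t ∧ ∀ q, ¬ σ.Spinning x q t

/-- Between `t` and `t'`, `x` has not left the segment in which it stands at time `t`. -/
def SameSegment (x : S.Inst) (t t' : ℝ) : Prop :=
  σ.work x t' < Segment.currentEnd (σ.prog x) (σ.work x t)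

/-- Vertex `v` of job `k` of task `i` is finished: it and all its ancestors have executed all
their code (so that a vertex without code finishes when its predecessors have finished). -/
def Finished (i : ι) (k : ℕ) (v : S.V i) (t : ℝ) : Prop :=
  σ.release i k ≤ t ∧ ∀ u, Relation.ReflTransGen (S.E i) u v →
    Segment.total (σ.prog ⟨i, (k, u)⟩) ≤ σ.work ⟨i, (k, u)⟩ t

/-- All predecessors are finished. -/
def Eligible (i : ι) (k : ℕ) (v : S.V i) (t : ℝ) : Prop :=
  σ.release i k ≤ t ∧ ∀ u, S.E i u v → σ.Finished i k u t

/-- The `k`-th job of task `i` is finished. -/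
def JobFinished (i : ι) (k : ℕ) (t : ℝ) : Prop :=
  σ.release i k ≤ t ∧ ∀ v, σ.Finished i k v t

/-- The response time of a job (`⊤` if it never finishes). -/
def responseTime (i : ι) (k : ℕ) : ℝ≥0∞ :=
  ⨅ t ∈ {t : ℝ | σ.JobFinished i k t}, ENNReal.ofReal (t - σ.release i k)

/-- The worst-case response time of a task: the supremum over all its jobs. -/
def wcrt (i : ι) : ℝ≥0∞ := ⨆ k, σ.responseTime i k

/-- The run respects the task parameters, the precedence constraints, work-conserving scheduling
of each task on its own processors, and the rules of non-nested, non-preemptive spin locks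
(with no assumption on the order in which requests are served). -/
structure IsLegal : Prop where
  /-- consecutive releases are at least one period apart -/
  period : ∀ i k, σ.release i k + S.T i ≤ σ.release i (k + 1)
  len_pos : ∀ x, ∀ s ∈ σ.prog x, 0 < s.len
  wcet : ∀ i k v, Segment.total (σ.prog ⟨i, (k, v)⟩) ≤ S.c i v
  accesses_le : ∀ i k q, ∑ v, Segment.accesses (σ.prog ⟨i, (k, v)⟩) q ≤ S.N i q
  access_len : ∀ x, ∀ s ∈ σ.prog x, ∀ q, s.res = some q → s.len ≤ S.L x.1 q
  sched_measurable : ∀ i p y, MeasurableSet {t | σ.sched i p t = some y}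
  /-- a vertex makes progress exactly while it executes -/
  work_eq : ∀ x t, σ.work x t = MeasureTheory.volume.real {s | s < t ∧ σ.Executing x s}
  /-- only eligible vertices that still have code to execute are scheduled -/
  sched_eligible : ∀ i p k v t, σ.sched i p t = some (k, v) →
    σ.Eligible i k v t ∧ σ.work ⟨i, (k, v)⟩ t < Segment.total (σ.prog ⟨i, (k, v)⟩)
  /-- no vertex occupies two processors at a time -/
  sched_injective : ∀ i p p' y t, σ.sched i p t = some y → σ.sched i p' t = some y → p = p'
  /-- if an eligible unfinished vertex is not scheduled, then no processor of its task is idle -/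
  work_conserving : ∀ i k v t, σ.Eligible i k v t → ¬ σ.Finished i k v t →
    ¬ σ.OnProc ⟨i, (k, v)⟩ t → ∀ p, σ.sched i p t ≠ none
  /-- spinning and holding a lock are non-preemptive -/
  nonpreemptive : ∀ i p k v q t t', σ.sched i p t = some (k, v) → σ.AtAccess ⟨i, (k, v)⟩ q t →
    t ≤ t' → σ.SameSegment ⟨i, (k, v)⟩ t t' → σ.sched i p t' = some (k, v)
  /-- a lock is held only by a scheduled vertex that is accessing the resource -/
  holder_access : ∀ q x t, σ.holder q t = some x → σ.OnProc x t ∧ σ.AtAccess x q t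
  /-- a lock is held until the access is completed -/
  holder_keeps : ∀ q x t t', σ.holder q t = some x → t ≤ t' → σ.SameSegment x t t' →
    σ.holder q t' = some x
  /-- a vertex spins for a lock only while another vertex holds it -/
  spinning_held : ∀ x q t, σ.Spinning x q t → σ.holder q t ≠ none

/-- Priority-ordered locks: no request of a lower-priority task is granted while a request of a
higher-priority task is spinning. That is, if the same request of `x` spins for `q` at `t` and at
`t' ≥ t`, and a lower-priority `y` holds `q` at `t'`, then this access of `y` was already holding
the lock at `t`. (While `x` spins, `work x` is constant, which identifies its request.) -/
def PriorityOrdered : Prop :=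
  ∀ q x y t t', t ≤ t' → σ.Spinning x q t → σ.Spinning x q t' → σ.work x t = σ.work x t' →
    S.prio y.1 < S.prio x.1 → σ.holder q t' = some y →
    σ.holder q t = some y ∧ σ.SameSegment y t t'

/-- The order among requests of one task. Under `fifo`, a request of `y` that is granted the lock
while a request of `x` of the same task is spinning must not have been issued later than that
request: it was already being spun for, or served, whenever `x` was spinning for its request. -/
def RespectsTies : TieBreak → Prop
  | .arbitrary => True
  | .fifo => ∀ q x y t t', t ≤ t' → σ.Spinning x q t → σ.Spinning x q t' →
      σ.work x t = σ.work x t' → y.1 = x.1 → σ.holder q t' = some y →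
      σ.OnProc y t ∧ σ.AtAccess y q t ∧ σ.SameSegment y t t'

end Run

/-! ### The quantities of the response time bound -/

/-- Total worst-case execution time of the task. -/
def totalWCET (i : ι) : ℝ := ∑ v, (S.c i v : ℝ)

/-- The length of a longest path of the DAG of the task. -/
def longestPath (i : ι) : ℝ :=
  sSup {ℓ : ℝ | ∃ π : List (S.V i), π.IsChain (S.E i) ∧ ℓ = (π.map fun v => (S.c i v : ℝ)).sum}

section Bound

variable [Fintype ι] [Fintype ρ]

/-- The tasks with a higher priority. -/
def higher (i : ι) : Finset ι := Finset.univ.filter fun j => S.prio i < S.prio j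

/-- The tasks with a lower priority. -/
def lower (i : ι) : Finset ι := Finset.univ.filter fun j => S.prio j < S.prio i

/-- The resources accessed by the task. -/
def resources (i : ι) : Finset ρ := Finset.univ.filter fun q => 0 < S.N i q

/-- The largest access time to `q` among the lower-priority tasks (`0` if there are none). -/
def maxLower (i : ι) (q : ρ) : ℝ≥0 := (S.lower i).sup fun j => S.L j q

/-- `η`: the number of jobs of `j` that may contend for `q` with one job of `i`. -/
def eta (i j : ι) (q : ρ) : ℕ :=
  if 0 < S.N i q ∧ 0 < S.N j q then ⌈(S.D i + S.D j) / S.T j⌉₊ else 0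

/-- The number of other requests of the same job that may be served before a given request. -/
def ownRequests (tie : TieBreak) (i : ι) (q : ρ) : ℕ :=
  match tie with
  | .arbitrary => S.N i q - 1
  | .fifo => min (S.m i) (S.N i q) - 1

/-- The delay of one request of `i` for `q` caused by one lower-priority access, by the jobs of
the higher-priority tasks that are active in a window of length `d`, and by the task itself. -/
def dprStep (tie : TieBreak) (i : ι) (q : ρ) (d : ℝ) : ℝ :=
  S.maxLower i q
    + ∑ j ∈ S.higher i, (⌈(d + S.D j) / S.T j⌉₊ : ℝ) * S.N j q * S.L j q
    + S.ownRequests tie i q * S.L i q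

/-- The fixed points of the delay-per-request recurrence. -/
def dprFixedPoints (tie : TieBreak) (i : ι) (q : ρ) : Set ℝ :=
  {d | 0 ≤ d ∧ S.dprStep tie i q d = d}

/-- The delay-per-request: the least fixed point of the recurrence, if there is one. -/
def dpr (tie : TieBreak) (i : ι) (q : ρ) : ℝ := sInf (S.dprFixedPoints tie i q)

open Classical in
/-- `Δ`: the number of jobs of `j` that may contend for `q` with a single request of `i`
(`⊤` if the delay-per-request recurrence has no fixed point). -/
def jobsPerRequest (tie : TieBreak) (i j : ι) (q : ρ) : ℕ∞ :=
  if 0 < S.N i q ∧ 0 < S.N j q then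
    if (S.dprFixedPoints tie i q).Nonempty then
      (⌈(S.dpr tie i q + S.D j) / S.T j⌉₊ : ℕ∞)
    else ⊤
  else 0

/-- The intra-task term `P^I(x)`. -/
def intraTerm (i : ι) (q : ρ) (x : ℕ) : ℝ :=
  let α : ℝ := min (S.N i q : ℝ) (S.m i)
  (((S.N i q : ℝ) - x) * ((S.m i : ℝ) - 1)
    - max (1 - (x : ℝ)) 0 * (α * ((S.m i : ℝ) - (α + 1) / 2))) * S.L i q

/-- The term `P^O_L(x)` of the lower-priority tasks. -/
def lowerTerm (i : ι) (q : ρ) (x : ℕ) : ℝ :=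
  ((S.N i q : ℝ) + ((S.m i : ℝ) - 1) * x) * S.maxLower i q

/-- The term `P^O_H(x)` of the higher-priority tasks. The minimum is taken in `ℕ∞`; it is finite
because its first argument is. -/
def higherTerm (tie : TieBreak) (i : ι) (q : ρ) (x : ℕ) : ℝ :=
  ∑ j ∈ S.higher i,
    ((min ((S.m i * S.eta i j q * S.N j q : ℕ) : ℕ∞)
      (((S.N i q + (S.m i - 1) * x : ℕ) : ℕ∞) * S.jobsPerRequest tie i j q * S.N j q)).toNat : ℝ)
      * S.L j q

/-- The response time bound for priority-ordered spin locks. -/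
def responseBound (tie : TieBreak) (i : ι) : ℝ :=
  (S.totalWCET i + ((S.m i : ℝ) - 1) * S.longestPath i
    + ∑ q ∈ S.resources i,
        (Finset.range (S.N i q + 1)).sup' Finset.nonempty_range_add_one fun x =>
          S.intraTerm i q x + (S.lowerTerm i q x + S.higherTerm tie i q x)) / S.m i

end Bound

end TaskSystem

end

/-!
While a job of `τ_i` is pending, each of its `m_i` processors is at every moment executing the job,
or accounted for by the progress of the *key path*, or *blocked* by spinning. The key path is the
chain of last-finishing predecessors that ends in the last vertex to finish; one of its vertices is
eligible and unfinished at every moment, so its length, at most `𝓛_i`, accounts for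
`(m_i - 1) 𝓛_i`. The blocked processor time on a resource is split according to whether the lock is
held by the task itself, by a lower-priority or by a higher-priority task, and the three parts are
bounded by `P^I(x)`, `P^O_L(x)` and `P^O_H(x)`, where `x` is the number of accesses on the key path.

These bounds count the jobs that are active in a window, which presupposes that the jobs in
question meet their deadlines. At the earliest missed deadline all deadlines before it are met, so
the bound `R'` is already available and contradicts the miss; hence no deadline is missed and the
bound holds for every job.
-/

open MeasureTheory

/-! ### Sums and integrals of counting functions -/

theorem setLIntegral_le_sum_of_subset_biUnion {α β : Type*} [MeasurableSpace α] {μ : Measure α}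
    {F : Finset β} {A : β → Set α} {B : Set α} (hB : B ⊆ ⋃ b ∈ F, A b) (f : α → ENNReal) :
    ∫⁻ a in B, f a ∂μ ≤ ∑ b ∈ F, ∫⁻ a in A b, f a ∂μ := by
  classical
  refine (lintegral_mono_set hB).trans ?_
  clear hB
  induction F using Finset.induction_on with
  | empty => simp
  | insert b F hb ih =>
    rw [Finset.set_biUnion_insert, Finset.sum_insert hb]
    exact (lintegral_union_le f _ _).trans (by gcongr)

open scoped Classical in
theorem measurable_card_filter {α β : Type*} [MeasurableSpace α] (F : Finset β)
    {p : β → α → Prop} (hp : ∀ b ∈ F, MeasurableSet {a | p b a}) :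
    Measurable fun a => (F.filter fun b => p b a).card := by
  simp only [Finset.card_filter]
  exact Finset.measurable_sum F fun b hb =>
    Measurable.ite (hp b hb) measurable_const measurable_const

open scoped Classical in
theorem setLIntegral_card_filter {α β : Type*} [MeasurableSpace α] {μ : Measure α} (F : Finset β)
    {p : β → α → Prop} (hp : ∀ b ∈ F, MeasurableSet {a | p b a}) (A : Set α) :
    ∫⁻ a in A, (F.filter fun b => p b a).card ∂μ = ∑ b ∈ F, μ {a | a ∈ A ∧ p b a} := by
  have hindicator : ∀ a, ((F.filter fun b => p b a).card : ENNReal) =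
      ∑ b ∈ F, {a | p b a}.indicator 1 a := fun a =>
    (Finset.sum_boole (fun b => p b a) F).symm
  simp only [hindicator]
  rw [lintegral_finsetSum F fun b hb => measurable_one.indicator (hp b hb)]
  refine Finset.sum_congr rfl fun b hb => ?_
  rw [lintegral_indicator_one (hp b hb), Measure.restrict_apply (hp b hb), Set.inter_comm]
  rfl

theorem setLIntegral_natCast_le {α : Type*} [MeasurableSpace α] {μ : Measure α} {A : Set α}
    {f : α → ℕ} {c : ℕ} {b : ENNReal} (hf : ∀ a ∈ A, f a ≤ c) (hA : μ A ≤ b) :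
    ∫⁻ a in A, f a ∂μ ≤ c * b := by
  calc ∫⁻ a in A, (f a : ENNReal) ∂μ ≤ ∫⁻ _ in A, (c : ENNReal) ∂μ :=
        setLIntegral_mono measurable_const fun a ha => by exact_mod_cast hf a ha
    _ = c * μ A := setLIntegral_const A _
    _ ≤ c * b := by gcongr

theorem ofReal_natCast_mul_coe (n : ℕ) (a : NNReal) :
    ENNReal.ofReal (n * a) = n * a := by
  rw [ENNReal.ofReal_mul n.cast_nonneg, ENNReal.ofReal_natCast, ENNReal.ofReal_coe_nnreal]

theorem sum_range_min_sub_one (N : ℕ) {m : ℕ} (hm : 0 < m) :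
    ((∑ c ∈ Finset.range N, min (m - 1) c : ℕ) : ℝ) =
      N * ((m : ℝ) - 1) - min (N : ℝ) m * ((m : ℝ) - (min (N : ℝ) m + 1) / 2) := by
  induction N with
  | zero => simp
  | succ N ih =>
    rw [Finset.sum_range_succ, Nat.cast_add, ih]
    push_cast [Nat.cast_sub (Nat.one_le_iff_ne_zero.2 hm.ne')]
    rcases Nat.lt_or_ge N m with hlt | hge
    · have hlt' : (N : ℝ) + 1 ≤ m := by exact_mod_cast hlt
      rw [min_eq_left (by linarith : (N : ℝ) ≤ m), min_eq_left hlt', min_eq_right (by linarith)]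
      ring
    · have hge' : (m : ℝ) ≤ N := by exact_mod_cast hge
      rw [min_eq_right hge', min_eq_right (by linarith : (m : ℝ) ≤ N + 1),
        min_eq_left (by linarith)]
      ring

/-! ### Programs -/

namespace Segment

variable {ρ : Type*} {l : List (Segment ρ)}

/-- The amount of execution after which the `n`-th segment of a program begins. -/
noncomputable def start (l : List (Segment ρ)) (n : ℕ) : ℝ := total (l.take n)

theorem start_zero (l : List (Segment ρ)) : start l 0 = 0 := by simp [start, total]

theorem start_cons_succ (s : Segment ρ) (l : List (Segment ρ)) (n : ℕ) :
    start (s :: l) (n + 1) = s.len + start l n := by simp [start, total]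

theorem start_succ {n : ℕ} (hn : n < l.length) : start l (n + 1) = start l n + l[n].len := by
  simp only [start, total, List.map_take]
  rw [List.sum_take_succ _ _ (by simpa using hn), List.getElem_map]

theorem start_mono (hl : ∀ s ∈ l, 0 ≤ s.len) : Monotone (start l) := fun n n' hn =>
  ((List.take_sublist_take_left hn).map len).sum_le_sum fun a ha => by
    obtain ⟨s, hs, rfl⟩ := List.mem_map.1 ha
    exact hl s (List.mem_of_mem_take hs)

theorem exists_of_current_eq_some {w : ℝ} {s : Segment ρ} (hw : 0 ≤ w)
    (h : current l w = some s) :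
    ∃ n, l[n]? = some s ∧ w ∈ Set.Ico (start l n) (start l (n + 1)) := by
  induction l generalizing w with
  | nil => simp [current] at h
  | cons a l ih =>
    rw [current] at h
    split_ifs at h with hlt
    · exact ⟨0, by simpa using h, by simpa [start_zero, start_cons_succ] using ⟨hw, hlt⟩⟩
    · obtain ⟨n, hn, hle, hlt'⟩ := ih (by linarith) h
      refine ⟨n + 1, by simpa using hn, ?_, ?_⟩ <;> rw [start_cons_succ] <;> linarith

theorem current_of_mem_Ico (hl : ∀ s ∈ l, 0 ≤ s.len) {w : ℝ} {s : Segment ρ} {n : ℕ}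
    (hn : l[n]? = some s) (hw : w ∈ Set.Ico (start l n) (start l (n + 1))) :
    current l w = some s ∧ currentEnd l w = start l (n + 1) := by
  induction l generalizing w n with
  | nil => simp at hn
  | cons a l ih =>
    have hl' : ∀ s ∈ l, 0 ≤ s.len := fun s hs => hl s (List.mem_cons_of_mem a hs)
    rw [current, currentEnd]
    cases n with
    | zero =>
      obtain rfl : a = s := by simpa using hn
      have hlt : w < a.len := by simpa [start_zero, start_cons_succ] using hw.2
      simp [hlt, start_zero, start_cons_succ]
    | succ n =>
      simp only [start_cons_succ, Set.mem_Ico] at hw ⊢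
      have hlt : ¬ w < a.len := by
        linarith [start_mono hl' (Nat.zero_le n), start_zero l]
      obtain ⟨hcur, hend⟩ :=
        ih hl' (by simpa using hn) (w := w - a.len) ⟨by linarith, by linarith⟩
      simp [hlt, hcur, hend]

open Classical in
/-- The positions of the accesses to `q` in a program. -/
noncomputable def accessIndices (l : List (Segment ρ)) (q : ρ) : Finset ℕ :=
  (l.findIdxs fun s => decide (s.res = some q)).toFinset

theorem mem_accessIndices {q : ρ} {n : ℕ} :
    n ∈ accessIndices l q ↔ ∃ s, l[n]? = some s ∧ s.res = some q := by
  simp [accessIndices, List.getElem?_eq_some_iff]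

theorem card_accessIndices (l : List (Segment ρ)) (q : ρ) :
    (accessIndices l q).card = accesses l q := by
  rw [accessIndices, List.toFinset_card_of_nodup List.nodup_findIdxs, List.length_findIdxs,
    accesses]

end Segment

/-! ### Requests -/

namespace TaskSystem

variable {ι ρ : Type*} {S : TaskSystem ι ρ}

theorem T_pos (S : TaskSystem ι ρ) (i : ι) : 0 < S.T i := (S.D_pos i).trans_le (S.D_le_T i)

variable (S) in
/-- A request of a vertex instance `x` is identified by the position `n` of the corresponding
access in the program of `x`; this type pairs `x` with an arbitrary position. -/
abbrev Request : Type _ := Σ _ : S.Inst, ℕ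

namespace Run

/-- The request `r` is for `q`, and its vertex instance stands in this access. -/
def AtRequest (σ : S.Run) (r : S.Request) (q : ρ) (t : ℝ) : Prop :=
  r.2 ∈ Segment.accessIndices (σ.prog r.1) q ∧
    σ.work r.1 t ∈ Set.Ico (Segment.start (σ.prog r.1) r.2) (Segment.start (σ.prog r.1) (r.2 + 1))

/-- The request `r` for `q` is issued but not served: its vertex instance spins. -/
def Waiting (σ : S.Run) (r : S.Request) (q : ρ) (t : ℝ) : Prop :=
  σ.Spinning r.1 q t ∧ σ.AtRequest r q t

/-- The request `r` is being served: its vertex instance holds the lock of `q`. -/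
def Served (σ : S.Run) (r : S.Request) (q : ρ) (t : ℝ) : Prop :=
  σ.holder q t = some r.1 ∧ σ.AtRequest r q t

variable {σ : S.Run}

theorem AtAccess.resource_unique {x : S.Inst} {q q' : ρ} {t : ℝ} (hx : σ.AtAccess x q t)
    (hx' : σ.AtAccess x q' t) : q = q' := by
  obtain ⟨s, hs, hq⟩ := hx
  obtain ⟨s', hs', hq'⟩ := hx'
  obtain rfl : s = s' := Option.some_inj.1 (hs.symm.trans hs')
  exact Option.some_inj.1 (hq.symm.trans hq')

namespace IsLegal

variable (h : σ.IsLegal)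
include h

theorem eligible_and_work_lt {x : S.Inst} {t : ℝ} (hx : σ.OnProc x t) :
    σ.Eligible x.1 x.2.1 x.2.2 t ∧ σ.work x t < Segment.total (σ.prog x) := by
  obtain ⟨p, hp⟩ := hx
  exact h.sched_eligible x.1 p x.2.1 x.2.2 t hp

theorem release_le {x : S.Inst} {t : ℝ} (hx : σ.OnProc x t) : σ.release x.1 x.2.1 ≤ t :=
  (h.eligible_and_work_lt hx).1.1

theorem work_nonneg (x : S.Inst) (t : ℝ) : 0 ≤ σ.work x t := by
  rw [h.work_eq]
  exact measureReal_nonneg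

theorem work_eq_zero_of_le_release {x : S.Inst} {t : ℝ} (ht : t ≤ σ.release x.1 x.2.1) :
    σ.work x t = 0 := by
  have hempty : {s | s < t ∧ σ.Executing x s} = ∅ :=
    Set.eq_empty_of_forall_notMem fun s hs =>
      (hs.1.trans_le ht).not_ge (h.release_le hs.2.1)
  rw [h.work_eq, hempty, measureReal_empty]

theorem work_eq_add {x : S.Inst} {t t' : ℝ} (ht : t ≤ t') :
    σ.work x t' = σ.work x t + volume.real {s | s ∈ Set.Ico t t' ∧ σ.Executing x s} := by
  have hfin : volume {s | s < t' ∧ σ.Executing x s} ≠ ⊤ :=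
    measure_ne_top_of_subset (s := Set.Ico (σ.release x.1 x.2.1) t')
      (fun s hs => ⟨h.release_le hs.2.1, hs.1⟩) measure_Ico_lt_top.ne
  rw [h.work_eq, h.work_eq, ← measureReal_inter_add_sdiff (measurableSet_Iio (a := t)) hfin]
  congr 2
  · ext s
    exact ⟨fun hs => ⟨hs.2, hs.1.2⟩, fun hs => ⟨⟨hs.1.trans_le ht, hs.2⟩, hs.1⟩⟩
  · ext s
    simp only [Set.mem_sdiff, Set.mem_ofPred_eq, Set.mem_Iio, not_lt, Set.mem_Ico]
    tauto

theorem work_mono (x : S.Inst) : Monotone (σ.work x) := fun t t' ht => by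
  rw [h.work_eq_add ht]
  exact le_add_of_nonneg_right measureReal_nonneg

theorem work_le_add {x : S.Inst} {t t' : ℝ} (ht : t ≤ t') :
    σ.work x t' ≤ σ.work x t + (t' - t) := by
  have hle : volume.real {s | s ∈ Set.Ico t t' ∧ σ.Executing x s} ≤ volume.real (Set.Ico t t') :=
    measureReal_mono (fun s hs => hs.1) (by simp)
  rw [Real.volume_real_Ico_of_le ht] at hle
  rw [h.work_eq_add ht]
  gcongr

theorem work_continuous (x : S.Inst) : Continuous (σ.work x) := by
  refine (LipschitzWith.of_le_add fun t t' => ?_).continuous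
  rcases le_total t t' with ht | ht
  · exact (h.work_mono x ht).trans (le_add_of_nonneg_right dist_nonneg)
  · rw [Real.dist_eq, abs_of_nonneg (sub_nonneg.2 ht)]
    exact h.work_le_add ht

theorem volume_le_of_work_mem_Icc {x : S.Inst} {A : Set ℝ} {a b : ℝ} (hA : BddAbove A)
    (hex : ∀ s ∈ A, σ.Executing x s) (hw : ∀ s ∈ A, σ.work x s ∈ Set.Icc a b) :
    volume A ≤ ENNReal.ofReal (b - a) := by
  rcases A.eq_empty_or_nonempty with rfl | hne
  · simp
  have hA' : BddBelow A := ⟨σ.release x.1 x.2.1, fun s hs => h.release_le (hex s hs).1⟩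
  have hclosure : ∀ s ∈ closure A, σ.work x s ∈ Set.Icc a b :=
    closure_minimal hw (isClosed_Icc.preimage (h.work_continuous x))
  have hinf := hclosure _ (csInf_mem_closure hne hA')
  have hsup := hclosure _ (csSup_mem_closure hne hA)
  have hsub : A ⊆ insert (sSup A) {s | s ∈ Set.Ico (sInf A) (sSup A) ∧ σ.Executing x s} :=
    fun s hs => (le_csSup hA hs).eq_or_lt.imp id fun hlt => ⟨⟨csInf_le hA' hs, hlt⟩, hex s hs⟩
  have hfin : volume {s | s ∈ Set.Ico (sInf A) (sSup A) ∧ σ.Executing x s} ≠ ⊤ :=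
    measure_ne_top_of_subset (fun s hs => hs.1) measure_Ico_lt_top.ne
  calc volume A ≤ volume {s | s ∈ Set.Ico (sInf A) (sSup A) ∧ σ.Executing x s} :=
        (measure_mono hsub).trans_eq (measure_congr (insert_ae_eq_self _ _))
    _ = ENNReal.ofReal (volume.real {s | s ∈ Set.Ico (sInf A) (sSup A) ∧ σ.Executing x s}) :=
        (ofReal_measureReal hfin).symm
    _ ≤ ENNReal.ofReal (b - a) := by
        have hadd := h.work_eq_add (x := x) (csInf_le_csSup hne hA' hA)
        exact ENNReal.ofReal_le_ofReal (by linarith [hinf.1, hsup.2])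

theorem volume_executing_work_mem_Icc_le (x : S.Inst) (a b : ℝ) :
    volume {s | σ.Executing x s ∧ σ.work x s ∈ Set.Icc a b} ≤ ENNReal.ofReal (b - a) := by
  set A := {s | σ.Executing x s ∧ σ.work x s ∈ Set.Icc a b}
  have hmono : Monotone fun n : ℕ => A ∩ Set.Iic (n : ℝ) := fun n n' hn =>
    Set.inter_subset_inter_right A (Set.Iic_subset_Iic.2 (by exact_mod_cast hn))
  have hA : A = ⋃ n : ℕ, A ∩ Set.Iic (n : ℝ) := by
    have huniv : ⋃ n : ℕ, Set.Iic (n : ℝ) = Set.univ := Set.iUnion_eq_univ_iff.2 exists_nat_ge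
    rw [← Set.inter_iUnion, huniv, Set.inter_univ]
  rw [hA, hmono.measure_iUnion]
  exact iSup_le fun n => h.volume_le_of_work_mem_Icc (bddAbove_Iic.mono Set.inter_subset_right)
    (fun s hs => hs.1.1) fun s hs => hs.1.2

theorem atAccess_iff {x : S.Inst} {q : ρ} {t : ℝ} :
    σ.AtAccess x q t ↔ ∃ n, σ.AtRequest ⟨x, n⟩ q t := by
  constructor
  · rintro ⟨s, hs, hq⟩
    obtain ⟨n, hn, hw⟩ := Segment.exists_of_current_eq_some (h.work_nonneg x t) hs
    exact ⟨n, Segment.mem_accessIndices.2 ⟨s, hn, hq⟩, hw⟩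
  · rintro ⟨n, hn, hw⟩
    obtain ⟨s, hs, hq⟩ := Segment.mem_accessIndices.1 hn
    exact ⟨s, (Segment.current_of_mem_Ico (fun s hs => (h.len_pos x s hs).le) hs hw).1, hq⟩

theorem sameSegment_iff {r : S.Request} {q : ρ} {t t' : ℝ} (hr : σ.AtRequest r q t) :
    σ.SameSegment r.1 t t' ↔ σ.work r.1 t' < Segment.start (σ.prog r.1) (r.2 + 1) := by
  obtain ⟨s, hs, -⟩ := Segment.mem_accessIndices.1 hr.1
  rw [SameSegment,
    (Segment.current_of_mem_Ico (fun s hs => (h.len_pos r.1 s hs).le) hs hr.2).2]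

theorem atRequest_unique {r r' : S.Request} {q q' : ρ} {t : ℝ} (hr : σ.AtRequest r q t)
    (hr' : σ.AtRequest r' q' t) (hx : r.1 = r'.1) : r = r' := by
  obtain ⟨x, n⟩ := r
  obtain ⟨x', n'⟩ := r'
  obtain rfl : x = x' := hx
  have hmono := Segment.start_mono fun s hs => (h.len_pos x s hs).le
  have hle : n ≤ n' := Nat.lt_succ_iff.1 (hmono.reflect_lt (hr.2.1.trans_lt hr'.2.2))
  have hge : n' ≤ n := Nat.lt_succ_iff.1 (hmono.reflect_lt (hr'.2.1.trans_lt hr.2.2))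
  rw [hle.antisymm hge]

theorem atRequest_of_le {r : S.Request} {q : ρ} {t t' : ℝ} (hr : σ.AtRequest r q t)
    (ht : t ≤ t') (hsame : σ.SameSegment r.1 t t') : σ.AtRequest r q t' :=
  ⟨hr.1, hr.2.1.trans (h.work_mono r.1 ht), (h.sameSegment_iff hr).1 hsame⟩

theorem atRequest_of_sameSegment {r : S.Request} {q : ρ} {t t' : ℝ}
    (hr : σ.AtRequest r q t') (ht : t ≤ t') (hat : σ.AtAccess r.1 q t)
    (hsame : σ.SameSegment r.1 t t') : σ.AtRequest r q t := by
  obtain ⟨n, hn⟩ := h.atAccess_iff.1 hat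
  rwa [h.atRequest_unique hr (h.atRequest_of_le hn ht hsame) rfl]

theorem executing_of_holder {x : S.Inst} {q : ρ} {t : ℝ} (hx : σ.holder q t = some x) :
    σ.Executing x t := by
  obtain ⟨hon, hat⟩ := h.holder_access q x t hx
  refine ⟨hon, fun q' hs => hs.2.2 ?_⟩
  rw [← hat.resource_unique hs.2.1, hx]

theorem waiting_of_mem_Icc {r : S.Request} {q : ρ} {t t' s : ℝ} (ht : σ.Waiting r q t)
    (ht' : σ.Waiting r q t') (hs : s ∈ Set.Icc t t') : σ.Waiting r q s := by
  have hsame : σ.SameSegment r.1 t s :=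
    (h.sameSegment_iff ht.2).2 ((h.work_mono r.1 hs.2).trans_lt ht'.2.2.2)
  have hat : σ.AtRequest r q s := h.atRequest_of_le ht.2 hs.1 hsame
  obtain ⟨⟨p, hp⟩, hacc, -⟩ := ht.1
  refine ⟨⟨⟨p, ?_⟩, h.atAccess_iff.2 ⟨r.2, hat⟩, fun hhold => ht'.1.2.2 ?_⟩, hat⟩
  · exact h.nonpreemptive r.1.1 p r.1.2.1 r.1.2.2 q t s hp hacc hs.1 hsame
  · exact h.holder_keeps q r.1 s t' hhold hs.2 ((h.sameSegment_iff hat).2 ht'.2.2.2)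

theorem work_eq_of_waiting {r : S.Request} {q : ρ} {t t' : ℝ} (ht : σ.Waiting r q t)
    (ht' : σ.Waiting r q t') (hle : t ≤ t') : σ.work r.1 t = σ.work r.1 t' := by
  have hempty : {s | s ∈ Set.Ico t t' ∧ σ.Executing r.1 s} = ∅ :=
    Set.eq_empty_of_forall_notMem fun s hs =>
      hs.2.2 q (h.waiting_of_mem_Icc ht ht' (Set.Ico_subset_Icc_self hs.1)).1
  rw [h.work_eq_add hle, hempty, measureReal_empty, add_zero]

theorem exists_waiting {x : S.Inst} {q : ρ} {t : ℝ} (hx : σ.Spinning x q t) :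
    ∃ n, σ.Waiting ⟨x, n⟩ q t :=
  (h.atAccess_iff.1 hx.2.1).imp fun _ hn => ⟨hx, hn⟩

theorem exists_served {y : S.Inst} {q : ρ} {t : ℝ} (hy : σ.holder q t = some y) :
    ∃ n, σ.Served ⟨y, n⟩ q t :=
  (h.atAccess_iff.1 (h.holder_access q y t hy).2).imp fun _ hn => ⟨hy, hn⟩

theorem volume_served_le (r : S.Request) (q : ρ) :
    volume {s | σ.Served r q s} ≤ S.L r.1.1 q := by
  by_cases hr : r.2 ∈ Segment.accessIndices (σ.prog r.1) q
  · obtain ⟨g, hg, hq⟩ := Segment.mem_accessIndices.1 hr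
    obtain ⟨hlt, rfl⟩ := List.getElem?_eq_some_iff.1 hg
    calc volume {s | σ.Served r q s}
        ≤ volume {s | σ.Executing r.1 s ∧ σ.work r.1 s ∈
            Set.Icc (Segment.start (σ.prog r.1) r.2) (Segment.start (σ.prog r.1) (r.2 + 1))} :=
          measure_mono fun s hs => ⟨h.executing_of_holder hs.1, Set.Ico_subset_Icc_self hs.2.2⟩
      _ ≤ ENNReal.ofReal (σ.prog r.1)[r.2].len := by
          refine (h.volume_executing_work_mem_Icc_le _ _ _).trans_eq ?_
          rw [Segment.start_succ hlt, add_sub_cancel_left]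
      _ ≤ S.L r.1.1 q :=
          ENNReal.ofReal_le_coe.2 (h.access_len r.1 _ (List.getElem_mem hlt) q hq)
  · have hempty : {s | σ.Served r q s} = ∅ :=
      Set.eq_empty_of_forall_notMem fun s hs => hr hs.2.1
    simp [hempty]

theorem volume_le_sum_of_forall_exists_served {R : Finset S.Request} {q : ρ} {A : Set ℝ}
    (hR : ∀ s ∈ A, ∃ r ∈ R, σ.Served r q s) : volume A ≤ ∑ r ∈ R, (S.L r.1.1 q : ENNReal) := by
  have hsub : A ⊆ ⋃ r ∈ R, {s | σ.Served r q s} := fun s hs => by simpa using hR s hs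
  calc volume A ≤ ∑ r ∈ R, volume {s | σ.Served r q s} :=
        (measure_mono hsub).trans (measure_biUnion_finset_le R _)
    _ ≤ ∑ r ∈ R, (S.L r.1.1 q : ENNReal) := Finset.sum_le_sum fun r _ => h.volume_served_le r q

end IsLegal

end Run

end TaskSystem

/-! ### Active jobs and lock holding times -/

namespace TaskSystem

open scoped Classical in
/-- The vertex instances that make up the `k`-th job of task `i`. -/
noncomputable def jobInsts {ι ρ : Type*} (S : TaskSystem ι ρ) (i : ι) (k : ℕ) : Finset S.Inst :=
  Finset.univ.image fun v => ⟨i, (k, v)⟩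

variable {ι ρ : Type*} {S : TaskSystem ι ρ}

theorem mem_jobInsts {i : ι} {k : ℕ} {x : S.Inst} :
    x ∈ S.jobInsts i k ↔ x.1 = i ∧ x.2.1 = k := by
  obtain ⟨j, k', v⟩ := x
  constructor
  · simp only [jobInsts, Finset.mem_image, Finset.mem_univ, true_and]
    rintro ⟨w, hw⟩
    cases hw
    exact ⟨rfl, rfl⟩
  · rintro ⟨rfl, rfl⟩
    simp [jobInsts]

theorem sum_jobInsts {M : Type*} [AddCommMonoid M] (i : ι) (k : ℕ) (f : S.Inst → M) :
    ∑ x ∈ S.jobInsts i k, f x = ∑ v, f ⟨i, (k, v)⟩ := by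
  classical
  exact Finset.sum_image fun v _ w _ hvw => by simpa using hvw

namespace Run

/-- The absolute deadline of the `k`-th job of task `i`. -/
def deadline (σ : S.Run) (i : ι) (k : ℕ) : ℝ := σ.release i k + S.D i

/-- Every job whose absolute deadline is before `t` meets its deadline. This is the induction
hypothesis of the schedulability argument. -/
def MeetsDeadlinesBefore (σ : S.Run) (t : ℝ) : Prop :=
  ∀ i k, σ.deadline i k < t → σ.JobFinished i k (σ.deadline i k)

/-- The requests for `q` issued by the vertex instances in `X`. -/
noncomputable def requests (σ : S.Run) (X : Finset S.Inst) (q : ρ) : Finset S.Request :=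
  X.sigma fun x => Segment.accessIndices (σ.prog x) q

/-- The lock of `q` is held by a vertex of task `j`. -/
def HeldBy (σ : S.Run) (q : ρ) (j : ι) (t : ℝ) : Prop :=
  ∃ y, σ.holder q t = some y ∧ y.1 = j

variable {σ : S.Run}

theorem mem_requests {X : Finset S.Inst} {q : ρ} {r : S.Request} :
    r ∈ σ.requests X q ↔ r.1 ∈ X ∧ r.2 ∈ Segment.accessIndices (σ.prog r.1) q :=
  Finset.mem_sigma

theorem card_onProc_le {i : ι} {s : ℝ} {X : Finset S.Inst}
    (hX : ∀ x ∈ X, x.1 = i ∧ σ.OnProc x s) : X.card ≤ S.m i := by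
  classical
  let busy : Fin (S.m i) → Option S.Inst := fun p => (σ.sched i p s).map (Sigma.mk i)
  have hsub : X.map .some ⊆ Finset.univ.image busy := by
    intro _ hx
    obtain ⟨⟨j, y⟩, hxX, rfl⟩ := Finset.mem_map.1 hx
    obtain ⟨rfl, p, hp⟩ := hX _ hxX
    exact Finset.mem_image.2 ⟨p, Finset.mem_univ p, by simp [busy, hp]⟩
  calc X.card = (X.map .some).card := (Finset.card_map _).symm
    _ ≤ (Finset.univ.image busy).card := Finset.card_le_card hsub
    _ ≤ S.m i := Finset.card_image_le.trans_eq (Finset.card_fin _)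

namespace IsLegal

variable (h : σ.IsLegal)
include h

theorem card_requests_le {i : ι} {k : ℕ} {X : Finset S.Inst} (hX : X ⊆ S.jobInsts i k) (q : ρ) :
    (σ.requests X q).card ≤ S.N i q := by
  calc (σ.requests X q).card ≤ (σ.requests (S.jobInsts i k) q).card :=
        Finset.card_le_card (Finset.sigma_mono hX fun _ => subset_rfl)
    _ = ∑ v, Segment.accesses (σ.prog ⟨i, (k, v)⟩) q := by
        simp only [requests, Finset.card_sigma, Segment.card_accessIndices, sum_jobInsts]
    _ ≤ S.N i q := h.accesses_le i k q

theorem release_add_mul_le (i : ι) (k n : ℕ) :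
    σ.release i k + n * S.T i ≤ σ.release i (k + n) := by
  induction n with
  | zero => simp
  | succ n ih =>
    have hperiod := h.period i (k + n)
    push_cast
    rw [← add_assoc]
    linarith

theorem release_mono (i : ι) : Monotone (σ.release i) :=
  monotone_nat_of_le_succ fun k => by linarith [h.period i k, S.T_pos i]

theorem exists_Ico_of_release_mem_Ioc (i : ι) (a b : ℝ) :
    ∃ k₀, ∀ k, σ.release i k ∈ Set.Ioc a b →
      k ∈ Finset.Ico k₀ (k₀ + ⌈(b - a) / S.T i⌉₊) := by
  set K : Set ℕ := {k | σ.release i k ∈ Set.Ioc a b}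
  refine ⟨sInf K, fun k (hk : k ∈ K) => Finset.mem_Ico.2 ⟨Nat.sInf_le hk, ?_⟩⟩
  obtain ⟨n, hn⟩ := Nat.exists_eq_add_of_le (Nat.sInf_le hk)
  have hfirst : σ.release i (sInf K) ∈ Set.Ioc a b := Nat.sInf_mem ⟨k, hk⟩
  have hlast : σ.release i k ≤ b := hk.2
  have hlt : (n : ℝ) < (b - a) / S.T i := by
    rw [hn] at hlast
    rw [lt_div_iff₀ (S.T_pos i)]
    linarith [h.release_add_mul_le i (sInf K) n, hfirst.1]
  have := Nat.lt_ceil.2 hlt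
  omega

theorem lt_deadline_of_onProc {t s : ℝ} (hmet : σ.MeetsDeadlinesBefore t) (hs : s < t)
    {x : S.Inst} (hx : σ.OnProc x s) : s < σ.deadline x.1 x.2.1 := by
  by_contra! hle
  have hfin := ((hmet x.1 x.2.1 (hle.trans_lt hs)).2 x.2.2).2 x.2.2 .refl
  exact ((hfin.trans (h.work_mono x hle)).trans_lt (h.eligible_and_work_lt hx).2).false

/-- Since deadlines are at most periods, jobs of one task do not overlap. -/
theorem mem_jobInsts_of_onProc {t s : ℝ} (hmet : σ.MeetsDeadlinesBefore t) {i : ι} {k : ℕ}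
    (ht : t ≤ σ.deadline i k) (hs : s ∈ Set.Ico (σ.release i k) t) {x : S.Inst}
    (hx : σ.OnProc x s) (hi : x.1 = i) : x ∈ S.jobInsts i k := by
  subst hi
  have hdl := h.lt_deadline_of_onProc hmet hs.2 hx
  have hrel := h.release_le hx
  have hD := S.D_le_T x.1
  rw [deadline] at ht hdl
  refine mem_jobInsts.2 ⟨rfl, ?_⟩
  rcases Nat.lt_trichotomy x.2.1 k with hlt | heq | hlt
  · linarith [h.period x.1 x.2.1, h.release_mono x.1 (Nat.succ_le_of_lt hlt), hs.1]
  · exact heq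
  · linarith [h.period x.1 k, h.release_mono x.1 (Nat.succ_le_of_lt hlt), hs.2]

/-- A job of `j` active in `[u, v]` is released in `(u - D j, v]`. -/
theorem volume_heldBy_le {t : ℝ} (hmet : σ.MeetsDeadlinesBefore t) {j : ι} {q : ρ} {A : Set ℝ}
    {u v : ℝ} (hA : ∀ s ∈ A, ∀ y, σ.holder q s = some y → y.1 = j →
      ∃ s' ∈ Set.Icc u v, s' < t ∧ σ.OnProc y s') :
    volume {s | s ∈ A ∧ σ.HeldBy q j s} ≤
      ((⌈(v - u + S.D j) / S.T j⌉₊ * S.N j q * S.L j q : NNReal) : ENNReal) := by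
  classical
  obtain ⟨k₀, hk₀⟩ := h.exists_Ico_of_release_mem_Ioc j (u - S.D j) v
  rw [show v - (u - S.D j) = v - u + S.D j by ring] at hk₀
  set K := Finset.Ico k₀ (k₀ + ⌈(v - u + S.D j) / S.T j⌉₊) with hK
  set R := K.biUnion fun k => σ.requests (S.jobInsts j k) q
  have htask : ∀ r ∈ R, r.1.1 = j := fun r hr => by
    obtain ⟨k, -, hrk⟩ := Finset.mem_biUnion.1 hr
    exact (mem_jobInsts.1 (mem_requests.1 hrk).1).1
  have hcard : R.card ≤ ⌈(v - u + S.D j) / S.T j⌉₊ * S.N j q := by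
    refine (Finset.card_biUnion_le_card_mul K _ _ fun k _ =>
      h.card_requests_le subset_rfl q).trans_eq ?_
    rw [hK, Nat.card_Ico, Nat.add_sub_cancel_left]
  have hserved : ∀ s ∈ {s | s ∈ A ∧ σ.HeldBy q j s}, ∃ r ∈ R, σ.Served r q s := by
    rintro s ⟨hs, ⟨_, k, v⟩, hy, rfl⟩
    obtain ⟨n, hn⟩ := h.exists_served hy
    obtain ⟨s', hs', hs't, hon⟩ := hA s hs _ hy rfl
    have hrel : σ.release _ k ≤ s' := h.release_le hon
    have hdl : s' < σ.release _ k + S.D _ := h.lt_deadline_of_onProc hmet hs't hon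
    have hkK : k ∈ K := hk₀ k ⟨by linarith [hs'.1], hrel.trans hs'.2⟩
    exact ⟨_, Finset.mem_biUnion.2
      ⟨k, hkK, mem_requests.2 ⟨mem_jobInsts.2 ⟨rfl, rfl⟩, hn.2.1⟩⟩, hn⟩
  refine (h.volume_le_sum_of_forall_exists_served hserved).trans ?_
  rw [Finset.sum_congr rfl fun r hr => by rw [htask r hr], Finset.sum_const, nsmul_eq_mul]
  push_cast
  gcongr
  exact_mod_cast hcard

theorem volume_le_of_served_unique {q : ρ} {A : Set ℝ} {C : NNReal}
    (hserved : ∀ s ∈ A, ∃ r, σ.Served r q s ∧ S.L r.1.1 q ≤ C)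
    (hunique : ∀ s ∈ A, ∀ s' ∈ A, s ≤ s' → ∀ r r', σ.Served r q s → σ.Served r' q s' → r = r') :
    volume A ≤ C := by
  rcases A.eq_empty_or_nonempty with rfl | ⟨s₀, hs₀⟩
  · simp
  obtain ⟨r₀, hr₀, hC⟩ := hserved s₀ hs₀
  have hsub : A ⊆ {s | σ.Served r₀ q s} := fun s hs => by
    obtain ⟨r, hr, -⟩ := hserved s hs
    obtain rfl : r = r₀ := (le_total s s₀).elim
      (fun hle => hunique s hs s₀ hs₀ hle r r₀ hr hr₀)
      fun hle => (hunique s₀ hs₀ s hs hle r₀ r hr₀ hr).symm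
    exact hr
  exact ((measure_mono hsub).trans (h.volume_served_le r₀ q)).trans (by exact_mod_cast hC)

/-- Priority order: the lower-priority access in progress when `r` is issued is the only one that
can delay `r`. -/
theorem served_eq_of_waiting (hprio : σ.PriorityOrdered) {r r₁ r₂ : S.Request} {q : ρ} {s s' : ℝ}
    (hs : σ.Waiting r q s) (hs' : σ.Waiting r q s') (hle : s ≤ s')
    (hlow : S.prio r₂.1.1 < S.prio r.1.1) (h₁ : σ.Served r₁ q s) (h₂ : σ.Served r₂ q s') :
    r₁ = r₂ := by
  obtain ⟨hhold, hsame⟩ := hprio q r.1 r₂.1 s s' hle hs.1 hs'.1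
    (h.work_eq_of_waiting hs hs' hle) hlow h₂.1
  exact h.atRequest_unique h₁.2
    (h.atRequest_of_sameSegment h₂.2 hle (h.holder_access q _ _ hhold).2 hsame)
    (Option.some_inj.1 (h₁.1.symm.trans hhold))

theorem volume_heldBy_lower_le [Fintype ι] (hprio : σ.PriorityOrdered) {r : S.Request} {q : ρ}
    {A : Set ℝ} (hA : ∀ s ∈ A, σ.Waiting r q s) :
    volume {s | s ∈ A ∧ ∃ j ∈ S.lower r.1.1, σ.HeldBy q j s} ≤ S.maxLower r.1.1 q := by
  refine h.volume_le_of_served_unique (q := q) ?_ ?_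
  · rintro s ⟨-, -, hj, y, hy, rfl⟩
    obtain ⟨n, hn⟩ := h.exists_served hy
    exact ⟨⟨y, n⟩, hn, Finset.le_sup (f := fun j => S.L j q) hj⟩
  · rintro s ⟨hs, -⟩ s' ⟨hs', -, hj, y, hy, rfl⟩ hle r₁ r₂ h₁ h₂
    obtain rfl : r₂.1 = y := Option.some_inj.1 (h₂.1.symm.trans hy)
    exact h.served_eq_of_waiting hprio (hA s hs) (hA s' hs') hle (Finset.mem_filter.1 hj).2 h₁ h₂

theorem volume_heldBy_own_le_of_subset {r : S.Request} {q : ρ} {A : Set ℝ} {F : Finset S.Request}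
    (hr : r ∈ F) (hF : ∀ r' ∈ F, r'.1.1 = r.1.1) (hA : ∀ s ∈ A, σ.Waiting r q s)
    (hserved : ∀ s ∈ A, ∀ r', σ.Served r' q s → r'.1.1 = r.1.1 → r' ∈ F) :
    volume {s | s ∈ A ∧ σ.HeldBy q r.1.1 s} ≤
      (((F.card - 1 : ℕ) * S.L r.1.1 q : NNReal) : ENNReal) := by
  classical
  have hcover : ∀ s ∈ {s | s ∈ A ∧ σ.HeldBy q r.1.1 s}, ∃ r' ∈ F.erase r, σ.Served r' q s := by
    rintro s ⟨hs, y, hy, hyi⟩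
    obtain ⟨n, hn⟩ := h.exists_served hy
    refine ⟨⟨y, n⟩, Finset.mem_erase.2 ⟨?_, hserved s hs _ hn hyi⟩, hn⟩
    rintro rfl
    exact (hA s hs).1.2.2 hn.1
  refine (h.volume_le_sum_of_forall_exists_served hcover).trans_eq ?_
  rw [Finset.sum_congr rfl fun r' hr' => by rw [hF r' (Finset.mem_of_mem_erase hr')],
    Finset.sum_const, nsmul_eq_mul, Finset.card_erase_of_mem hr]
  push_cast
  rfl

theorem card_requests_onProc_le {i : ι} {q : ρ} {s : ℝ} {F : Finset S.Request}
    (hF : ∀ r ∈ F, r.1.1 = i ∧ σ.OnProc r.1 s ∧ σ.AtRequest r q s) : F.card ≤ S.m i := by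
  classical
  have hinj : Set.InjOn Sigma.fst (F : Set S.Request) := fun r hr r' hr' heq =>
    h.atRequest_unique (hF r hr).2.2 (hF r' hr').2.2 heq
  rw [← Finset.card_image_of_injOn hinj]
  refine card_onProc_le (σ := σ) (s := s) fun x hx => ?_
  obtain ⟨r, hr, rfl⟩ := Finset.mem_image.1 hx
  exact ⟨(hF r hr).1, (hF r hr).2.1⟩

theorem volume_heldBy_own_le {tie : TieBreak} (htie : σ.RespectsTies tie) {t t₀ : ℝ}
    (hmet : σ.MeetsDeadlinesBefore t) {r : S.Request} {q : ρ} {A : Set ℝ}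
    (ht : t ≤ σ.deadline r.1.1 r.1.2.1) (hAt : A ⊆ Set.Ico t₀ t) (ht₀ : σ.Waiting r q t₀)
    (hA : ∀ s ∈ A, σ.Waiting r q s) :
    volume {s | s ∈ A ∧ σ.HeldBy q r.1.1 s} ≤
      ((S.ownRequests tie r.1.1 q * S.L r.1.1 q : NNReal) : ENNReal) := by
  classical
  set i := r.1.1
  set R := σ.requests (S.jobInsts i r.1.2.1) q
  have hrR : r ∈ R := mem_requests.2 ⟨mem_jobInsts.2 ⟨rfl, rfl⟩, ht₀.2.1⟩
  have hRi : ∀ r' ∈ R, r'.1.1 = i := fun r' hr' => (mem_jobInsts.1 (mem_requests.1 hr').1).1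
  have hRcard : R.card ≤ S.N i q := h.card_requests_le subset_rfl q
  have hR : ∀ s ∈ A, ∀ r', σ.Served r' q s → r'.1.1 = i → r' ∈ R := fun s hs r' hr' hi => by
    refine mem_requests.2 ⟨h.mem_jobInsts_of_onProc hmet ht ⟨?_, (hAt hs).2⟩
      (h.holder_access q _ s hr'.1).1 hi, hr'.2.1⟩
    exact (h.release_le ht₀.1.1).trans (hAt hs).1
  obtain ⟨F, hrF, hFi, hFcard, hF⟩ : ∃ F : Finset S.Request, r ∈ F ∧ (∀ r' ∈ F, r'.1.1 = i) ∧
      F.card - 1 ≤ S.ownRequests tie i q ∧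
      ∀ s ∈ A, ∀ r', σ.Served r' q s → r'.1.1 = i → r' ∈ F := by
    cases tie with
    | arbitrary => exact ⟨R, hrR, hRi, Nat.sub_le_sub_right hRcard 1, hR⟩
    | fifo =>
      -- A request served before `r` occupied a processor when `r` was already spinning.
      set F := R.filter fun r' => σ.OnProc r'.1 t₀ ∧ σ.AtRequest r' q t₀
      have hFR : F ⊆ R := Finset.filter_subset _ R
      have hFm : F.card ≤ S.m i := h.card_requests_onProc_le fun r' hr' =>
        ⟨hRi r' (hFR hr'), (Finset.mem_filter.1 hr').2⟩
      refine ⟨F, Finset.mem_filter.2 ⟨hrR, ht₀.1.1, ht₀.2⟩, fun r' hr' => hRi r' (hFR hr'),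
        Nat.sub_le_sub_right (le_min hFm ((Finset.card_le_card hFR).trans hRcard)) 1,
        fun s hs r' hr' hi => Finset.mem_filter.2 ⟨hR s hs r' hr' hi, ?_⟩⟩
      obtain ⟨hon, hacc, hsame⟩ := htie q r.1 r'.1 t₀ s (hAt hs).1 ht₀.1 (hA s hs).1
        (h.work_eq_of_waiting ht₀ (hA s hs) (hAt hs).1) hi hr'.1
      exact ⟨hon, h.atRequest_of_sameSegment hr'.2 (hAt hs).1 hacc hsame⟩
  refine (h.volume_heldBy_own_le_of_subset hrF hFi hA hF).trans ?_
  gcongr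

end IsLegal

end Run

end TaskSystem

/-! ### The delay per request -/

namespace TaskSystem.Run

variable {ι ρ : Type*} {S : TaskSystem ι ρ} {σ : S.Run}

theorem heldBy_lower_or_own_or_higher [Fintype ι] (i : ι) {q : ρ} {s : ℝ}
    (hs : σ.holder q s ≠ none) :
    (∃ j ∈ S.lower i, σ.HeldBy q j s) ∨ σ.HeldBy q i s ∨ ∃ j ∈ S.higher i, σ.HeldBy q j s := by
  obtain ⟨y, hy⟩ := Option.ne_none_iff_exists'.1 hs
  rcases lt_trichotomy (S.prio y.1) (S.prio i) with hlt | heq | hlt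
  · exact .inl ⟨y.1, by simpa [lower] using hlt, y, hy, rfl⟩
  · exact .inr (.inl ⟨y, hy, S.prio_injective heq⟩)
  · exact .inr (.inr ⟨y.1, by simpa [higher] using hlt, y, hy, rfl⟩)

namespace IsLegal

variable (h : σ.IsLegal)
include h

theorem exists_holder_eqOn_Ico {q : ρ} {u : ℝ} (hu : σ.holder q u ≠ none) :
    ∃ u' > u, ∀ s ∈ Set.Ico u u', σ.holder q s = σ.holder q u := by
  obtain ⟨y, hy⟩ := Option.ne_none_iff_exists'.1 hu
  obtain ⟨n, hn⟩ := h.exists_served hy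
  refine ⟨u + (Segment.start (σ.prog y) (n + 1) - σ.work y u),
    lt_add_of_pos_right _ (sub_pos.2 hn.2.2.2), fun s hs => ?_⟩
  rw [hy]
  exact h.holder_keeps q y u s hy hs.1 ((h.sameSegment_iff hn.2).2
    (by linarith [h.work_le_add (x := y) hs.1, hs.2]))

variable [Fintype ι]

theorem volume_le_dprStep (hprio : σ.PriorityOrdered) {tie : TieBreak}
    (htie : σ.RespectsTies tie) {t t₀ d : ℝ} (hmet : σ.MeetsDeadlinesBefore t) {r : S.Request}
    {q : ρ} {A : Set ℝ} (ht : t ≤ σ.deadline r.1.1 r.1.2.1) (hAt : A ⊆ Set.Ico t₀ t)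
    (ht₀ : σ.Waiting r q t₀) (hA : ∀ s ∈ A, σ.Waiting r q s)
    (hholder : ∀ s ∈ A, ∃ s' ∈ Set.Icc t₀ (t₀ + d), s' < t ∧ σ.holder q s' = σ.holder q s) :
    volume A ≤ ENNReal.ofReal (S.dprStep tie r.1.1 q d) := by
  have hlower := h.volume_heldBy_lower_le hprio hA
  have hown := h.volume_heldBy_own_le htie hmet ht hAt ht₀ hA
  have hhigher : ∀ j ∈ S.higher r.1.1, volume {s | s ∈ A ∧ σ.HeldBy q j s} ≤
      ((⌈(d + S.D j) / S.T j⌉₊ * S.N j q * S.L j q : NNReal) : ENNReal) := fun j _ => by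
    have hactive : ∀ s ∈ A, ∀ y, σ.holder q s = some y → y.1 = j →
        ∃ s' ∈ Set.Icc t₀ (t₀ + d), s' < t ∧ σ.OnProc y s' := fun s hs y hy _ => by
      obtain ⟨s', hs', hlt, heq⟩ := hholder s hs
      exact ⟨s', hs', hlt, (h.holder_access q y s' (heq.trans hy)).1⟩
    simpa only [add_sub_cancel_left] using h.volume_heldBy_le hmet hactive
  have hcover : A ⊆ {s | s ∈ A ∧ ∃ j ∈ S.lower r.1.1, σ.HeldBy q j s} ∪
      ((⋃ j ∈ S.higher r.1.1, {s | s ∈ A ∧ σ.HeldBy q j s}) ∪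
        {s | s ∈ A ∧ σ.HeldBy q r.1.1 s}) := fun s hs => by
    rcases heldBy_lower_or_own_or_higher r.1.1 (h.spinning_held _ q s (hA s hs).1) with
      hl | ho | ⟨j, hj, hh⟩
    · exact .inl ⟨hs, hl⟩
    · exact .inr (.inr ⟨hs, ho⟩)
    · exact .inr (.inl (Set.mem_biUnion hj ⟨hs, hh⟩))
  calc volume A
      ≤ S.maxLower r.1.1 q +
        (∑ j ∈ S.higher r.1.1, ((⌈(d + S.D j) / S.T j⌉₊ * S.N j q * S.L j q : NNReal) : ENNReal) +
          ((S.ownRequests tie r.1.1 q * S.L r.1.1 q : NNReal) : ENNReal)) :=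
        (measure_mono hcover).trans <| (measure_union_le _ _).trans <| add_le_add hlower <|
          (measure_union_le _ _).trans <| add_le_add
            ((measure_biUnion_finset_le _ _).trans (Finset.sum_le_sum hhigher)) hown
    _ = ENNReal.ofReal (S.dprStep tie r.1.1 q d) := by
        rw [← ENNReal.ofNNReal_toNNReal]
        norm_cast
        rw [← NNReal.coe_inj, Real.coe_toNNReal _ (by rw [dprStep]; positivity)]
        push_cast [dprStep]
        ring

theorem sub_le_of_mem_dprFixedPoints (hprio : σ.PriorityOrdered) {tie : TieBreak}
    (htie : σ.RespectsTies tie) {t t₀ u d : ℝ} (hmet : σ.MeetsDeadlinesBefore t) {r : S.Request}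
    {q : ρ} (ht : t ≤ σ.deadline r.1.1 r.1.2.1) (hu : u < t) (ht₀ : σ.Waiting r q t₀)
    (hwu : σ.Waiting r q u) (hd : d ∈ S.dprFixedPoints tie r.1.1 q) : u - t₀ ≤ d := by
  by_contra! hlt
  have hd₀ : 0 ≤ d := hd.1
  have hwait : ∀ s ∈ Set.Icc t₀ u, σ.Waiting r q s := fun s hs => h.waiting_of_mem_Icc ht₀ hwu hs
  obtain ⟨u', hu', hconst⟩ := h.exists_holder_eqOn_Ico
    (h.spinning_held _ q _ (hwait (t₀ + d) ⟨by linarith, by linarith⟩).1)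
  -- No lock is granted between `t₀ + d` and `u'`, so a window of length `d` contains a job of every
  -- access served before `u'`, and waiting until `u'` contradicts the recurrence.
  set A := Set.Ico t₀ (min u u')
  have hAu : ∀ s ∈ A, s < u := fun s hs => hs.2.trans_le (min_le_left u u')
  have hvol : volume A ≤ ENNReal.ofReal (S.dprStep tie r.1.1 q d) := by
    refine h.volume_le_dprStep hprio htie hmet ht (fun s hs => ⟨hs.1, (hAu s hs).trans hu⟩) ht₀
      (fun s hs => hwait s ⟨hs.1, (hAu s hs).le⟩) fun s hs => ?_
    rcases le_total s (t₀ + d) with hle | hle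
    · exact ⟨s, ⟨hs.1, hle⟩, (hAu s hs).trans hu, rfl⟩
    · exact ⟨t₀ + d, ⟨by linarith, le_rfl⟩, by linarith,
        (hconst s ⟨hle, hs.2.trans_le (min_le_right u u')⟩).symm⟩
  rw [hd.2, Real.volume_Ico, ENNReal.ofReal_le_ofReal_iff hd₀] at hvol
  have hgt : t₀ + d < min u u' := lt_min (by linarith) hu'
  linarith

theorem volume_heldBy_le_of_waiting (hprio : σ.PriorityOrdered) {tie : TieBreak}
    (htie : σ.RespectsTies tie) {t : ℝ} (hmet : σ.MeetsDeadlinesBefore t) {r : S.Request}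
    {q : ρ} {A : Set ℝ} (ht : t ≤ σ.deadline r.1.1 r.1.2.1) (hAt : ∀ s ∈ A, s < t)
    (hA : ∀ s ∈ A, σ.Waiting r q s) (hd : (S.dprFixedPoints tie r.1.1 q).Nonempty) (j : ι) :
    volume {s | s ∈ A ∧ σ.HeldBy q j s} ≤
      ((⌈(S.dpr tie r.1.1 q + S.D j) / S.T j⌉₊ * S.N j q * S.L j q : NNReal) : ENNReal) := by
  have hbdd : BddBelow A := ⟨σ.release r.1.1 r.1.2.1, fun s hs => h.release_le (hA s hs).1.1⟩
  have hdiam : ∀ s ∈ A, s ≤ sInf A + S.dpr tie r.1.1 q := fun s hs => by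
    refine sub_le_iff_le_add.1 (le_csInf ⟨s, hs⟩ fun s' hs' => sub_le_comm.1 ?_)
    exact le_csInf hd fun d hd => h.sub_le_of_mem_dprFixedPoints hprio htie hmet ht (hAt s hs)
      (hA s' hs') (hA s hs) hd
  simpa only [add_sub_cancel_left] using h.volume_heldBy_le hmet fun s hs y hy _ =>
    ⟨s, ⟨csInf_le hbdd hs, hdiam s hs⟩, hAt s hs, (h.holder_access q y s hy).1⟩

omit [Fintype ι] in
theorem volume_heldBy_pending_le {t : ℝ} (hmet : σ.MeetsDeadlinesBefore t) {i : ι} {k : ℕ}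
    (ht : t ≤ σ.deadline i k) (q : ρ) (j : ι) :
    volume {s | s ∈ Set.Ico (σ.release i k) t ∧ σ.HeldBy q j s} ≤
      ((⌈(S.D i + S.D j) / S.T j⌉₊ * S.N j q * S.L j q : NNReal) : ENNReal) := by
  have hactive : ∀ s ∈ Set.Ico (σ.release i k) t, ∀ y, σ.holder q s = some y → y.1 = j →
      ∃ s' ∈ Set.Icc (σ.release i k) (σ.deadline i k), s' < t ∧ σ.OnProc y s' := fun s hs y hy _ =>
    ⟨s, ⟨hs.1, hs.2.le.trans ht⟩, hs.2, (h.holder_access q y s hy).1⟩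
  simpa only [deadline, add_sub_cancel_left] using h.volume_heldBy_le hmet hactive

end IsLegal

end TaskSystem.Run

/-! ### Measurability -/

namespace TaskSystem.Run.IsLegal

variable {ι ρ : Type*} {S : TaskSystem ι ρ} {σ : S.Run} (h : σ.IsLegal)
include h

theorem measurableSet_waiting (r : S.Request) (q : ρ) : MeasurableSet {s | σ.Waiting r q s} :=
  Set.OrdConnected.measurableSet
    ⟨fun _ ht _ ht' _ hs => h.waiting_of_mem_Icc ht ht' hs⟩

theorem measurableSet_served (r : S.Request) (q : ρ) : MeasurableSet {s | σ.Served r q s} := by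
  refine Set.OrdConnected.measurableSet ⟨fun t ht t' ht' s hs => ?_⟩
  have hsame : σ.SameSegment r.1 t s :=
    (h.sameSegment_iff ht.2).2 ((h.work_mono r.1 hs.2).trans_lt ht'.2.2.2)
  exact ⟨h.holder_keeps q r.1 t s ht.1 hs.1 hsame, h.atRequest_of_le ht.2 hs.1 hsame⟩

theorem measurableSet_onProc (x : S.Inst) : MeasurableSet {s | σ.OnProc x s} := by
  simp only [OnProc, Set.ofPred_exists]
  exact .iUnion fun p => h.sched_measurable x.1 p x.2

theorem measurableSet_spinning (x : S.Inst) (q : ρ) : MeasurableSet {s | σ.Spinning x q s} := by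
  have hunion : {s | σ.Spinning x q s} = ⋃ n, {s | σ.Waiting ⟨x, n⟩ q s} := by
    ext s
    simp only [Set.mem_iUnion]
    exact ⟨fun hs => h.exists_waiting hs, fun ⟨n, hn⟩ => hn.1⟩
  rw [hunion]
  exact .iUnion fun n => h.measurableSet_waiting _ q

theorem measurableSet_executing [Countable ρ] (x : S.Inst) :
    MeasurableSet {s | σ.Executing x s} := by
  simp only [Executing, Set.ofPred_and, Set.ofPred_forall]
  exact (h.measurableSet_onProc x).inter (.iInter fun q => (h.measurableSet_spinning x q).compl)

theorem measurableSet_heldBy (q : ρ) (j : ι) : MeasurableSet {s | σ.HeldBy q j s} := by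
  have hunion : {s | σ.HeldBy q j s} =
      ⋃ (y : ℕ × S.V j) (n : ℕ), {s | σ.Served ⟨⟨j, y⟩, n⟩ q s} := by
    ext s
    simp only [Set.mem_iUnion]
    constructor
    · rintro ⟨y, hy, rfl⟩
      exact ⟨y.2, h.exists_served hy⟩
    · rintro ⟨y, n, hn⟩
      exact ⟨_, hn.1, rfl⟩
  rw [hunion]
  exact .iUnion fun y => .iUnion fun n => h.measurableSet_served _ q

end TaskSystem.Run.IsLegal

/-! ### Blocked processor time -/

namespace TaskSystem

variable {ι ρ : Type*} {S : TaskSystem ι ρ}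

namespace Run

open scoped Classical in
/-- The number of processors of task `i` at time `s` whose loss to the `k`-th job is charged to
resource `q`, when `P` is the key path of the job. While a vertex of `P` spins for `q`, these are
all processors but the one of a lock holder of task `i`; while a vertex of `P` occupies a processor
for another reason, there are none; otherwise they are the processors spinning for `q`. -/
noncomputable def blocking (σ : S.Run) (i : ι) (k : ℕ) (P : Finset S.Inst) (q : ρ) (s : ℝ) : ℕ :=
  if ∃ x ∈ P, σ.Spinning x q s then if σ.HeldBy q i s then S.m i - 1 else S.m i
  else if ∃ x ∈ P, σ.OnProc x s then 0
  else ((S.jobInsts i k).filter fun x => σ.Spinning x q s).card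

open scoped Classical in
/-- The number of accesses to `q` that the `k`-th job of task `i` has completed before `s`. -/
noncomputable def completed (σ : S.Run) (i : ι) (k : ℕ) (q : ρ) (s : ℝ) : ℕ :=
  ((σ.requests (S.jobInsts i k) q).filter fun r =>
    Segment.start (σ.prog r.1) (r.2 + 1) ≤ σ.work r.1 s).card

/-- At most one of the vertex instances in `P` occupies a processor at a time. -/
def Sequential (σ : S.Run) (P : Finset S.Inst) : Prop :=
  ∀ s, {x | x ∈ P ∧ σ.OnProc x s}.Subsingleton

variable {σ : S.Run} {i : ι} {k : ℕ} {P : Finset S.Inst} {q : ρ} {s : ℝ}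

theorem blocking_le : σ.blocking i k P q s ≤ S.m i := by
  classical
  rw [blocking]
  split_ifs
  · exact Nat.sub_le _ 1
  · exact le_rfl
  · exact Nat.zero_le _
  · refine card_onProc_le (σ := σ) (s := s) fun x hx => ?_
    have hx := Finset.mem_filter.1 hx
    exact ⟨(mem_jobInsts.1 hx.1).1, hx.2.1⟩

theorem blocking_eq_zero_of_holder_mem (hP : σ.Sequential P) {y : S.Inst} (hyP : y ∈ P)
    (hon : σ.OnProc y s) (hy : σ.holder q s = some y) : σ.blocking i k P q s = 0 := by
  have hspin : ¬ ∃ x ∈ P, σ.Spinning x q s := by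
    rintro ⟨x, hxP, hx⟩
    obtain rfl : x = y := hP s ⟨hxP, hx.1⟩ ⟨hyP, hon⟩
    exact hx.2.2 hy
  rw [blocking, if_neg hspin, if_pos ⟨y, hyP, hon⟩]

namespace IsLegal

variable (h : σ.IsLegal)
include h

theorem blocking_eq_zero_of_holder_eq_none (hq : σ.holder q s = none) :
    σ.blocking i k P q s = 0 := by
  have hspin : ∀ x, ¬ σ.Spinning x q s := fun x hx => h.spinning_held x q s hx hq
  simp [blocking, hspin]

theorem blocking_le_sub_one_of_heldBy (hq : σ.HeldBy q i s) :
    σ.blocking i k P q s ≤ S.m i - 1 := by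
  classical
  rw [blocking, if_pos hq]
  split_ifs
  · exact le_rfl
  · exact Nat.zero_le _
  · obtain ⟨y, hy, hyi⟩ := hq
    have hnot : y ∉ (S.jobInsts i k).filter fun x => σ.Spinning x q s := fun hmem =>
      (Finset.mem_filter.1 hmem).2.2.2 hy
    refine Nat.le_sub_one_of_lt (Nat.lt_iff_add_one_le.2 ?_)
    rw [← Finset.card_insert_of_notMem hnot]
    refine card_onProc_le (σ := σ) (s := s) fun x hx => ?_
    obtain rfl | hx := Finset.mem_insert.1 hx
    · exact ⟨hyi, (h.holder_access q x s hy).1⟩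
    · have hx := Finset.mem_filter.1 hx
      exact ⟨(mem_jobInsts.1 hx.1).1, hx.2.1⟩

open scoped Classical in
theorem card_spinning_le_card_waiting (X : Finset S.Inst) (q : ρ) (s : ℝ) :
    (X.filter fun x => σ.Spinning x q s).card ≤
      ((σ.requests X q).filter fun r => σ.Waiting r q s).card := by
  refine (Finset.card_le_card fun x hx => ?_).trans (Finset.card_image_le (f := Sigma.fst))
  obtain ⟨hxX, hx⟩ := Finset.mem_filter.1 hx
  obtain ⟨n, hn⟩ := h.exists_waiting hx
  exact Finset.mem_image.2
    ⟨⟨x, n⟩, Finset.mem_filter.2 ⟨mem_requests.2 ⟨hxX, hn.2.1⟩, hn⟩, rfl⟩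

open scoped Classical in
theorem blocking_le_card_waiting (hP : P ⊆ S.jobInsts i k) :
    σ.blocking i k P q s ≤
      (S.m i - 1) * ((σ.requests P q).filter fun r => σ.Waiting r q s).card +
        ((σ.requests (S.jobInsts i k) q).filter fun r => σ.Waiting r q s).card := by
  by_cases hspin : ∃ x ∈ P, σ.Spinning x q s
  · obtain ⟨x, hxP, hx⟩ := hspin
    have hpos : ∀ {X : Finset S.Inst}, x ∈ X →
        0 < ((σ.requests X q).filter fun r => σ.Waiting r q s).card := fun hxX =>
      (Finset.card_pos.2 ⟨x, Finset.mem_filter.2 ⟨hxX, hx⟩⟩).trans_le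
        (h.card_spinning_le_card_waiting _ q s)
    calc σ.blocking i k P q s ≤ S.m i := blocking_le
      _ ≤ (S.m i - 1) * 1 + 1 := by omega
      _ ≤ _ := by gcongr; exacts [hpos hxP, hpos (hP hxP)]
  · rw [blocking, if_neg hspin]
    split_ifs
    · exact Nat.zero_le _
    · exact (h.card_spinning_le_card_waiting _ q s).trans (Nat.le_add_left _ _)

/-- A request that is waiting is neither completed nor the one being served. -/
theorem blocking_add_completed_lt (hP : P ⊆ S.jobInsts i k) (hempty : σ.requests P q = ∅)
    {y : S.Inst} (hyJ : y ∈ S.jobInsts i k) (hy : σ.holder q s = some y) :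
    σ.blocking i k P q s + σ.completed i k q s < S.N i q := by
  classical
  set R := σ.requests (S.jobInsts i k) q
  set waiting := R.filter fun r => σ.Waiting r q s
  set done := R.filter fun r => Segment.start (σ.prog r.1) (r.2 + 1) ≤ σ.work r.1 s
  obtain ⟨n, hn⟩ := h.exists_served hy
  have hblock : σ.blocking i k P q s ≤ waiting.card := by
    simpa [hempty] using h.blocking_le_card_waiting (q := q) (s := s) hP
  have hdisj : Disjoint waiting done := Finset.disjoint_left.2 fun r hw hd =>
    ((Finset.mem_filter.1 hw).2.2.2.2.trans_le (Finset.mem_filter.1 hd).2).false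
  have hserved : ⟨y, n⟩ ∉ waiting ∪ done := fun hmem => by
    rcases Finset.mem_union.1 hmem with hw | hd
    · exact (Finset.mem_filter.1 hw).2.1.2.2 hy
    · exact (hn.2.2.2.trans_le (Finset.mem_filter.1 hd).2).false
  have hsub : insert ⟨y, n⟩ (waiting ∪ done) ⊆ R := Finset.insert_subset
    (mem_requests.2 ⟨hyJ, hn.2.1⟩)
    (Finset.union_subset (Finset.filter_subset _ R) (Finset.filter_subset _ R))
  calc σ.blocking i k P q s + done.card < waiting.card + done.card + 1 := by omega
    _ = (insert ⟨y, n⟩ (waiting ∪ done)).card := by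
      rw [Finset.card_insert_of_notMem hserved, Finset.card_union_of_disjoint hdisj]
    _ ≤ R.card := Finset.card_le_card hsub
    _ ≤ S.N i q := h.card_requests_le subset_rfl q

theorem completed_lt_completed {r : S.Request} {s' : ℝ} (hr : σ.Served r q s)
    (hrJ : r.1 ∈ S.jobInsts i k) (hs : s ≤ s')
    (hdone : Segment.start (σ.prog r.1) (r.2 + 1) ≤ σ.work r.1 s') :
    σ.completed i k q s < σ.completed i k q s' := by
  classical
  refine Finset.card_lt_card ⟨Finset.monotone_filter_right _ fun r' _ hr' =>
    hr'.trans (h.work_mono r'.1 hs), fun hsub => ?_⟩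
  have hmem := hsub (Finset.mem_filter.2 ⟨mem_requests.2 ⟨hrJ, hr.2.1⟩, hdone⟩)
  exact (hr.2.2.2.trans_le (Finset.mem_filter.1 hmem).2).false

theorem volume_completed_eq_le {A : Set ℝ}
    (hA : ∀ s ∈ A, ∃ y ∈ S.jobInsts i k, σ.holder q s = some y) (c : ℕ) :
    volume {s | s ∈ A ∧ σ.completed i k q s = c} ≤ S.L i q := by
  have hmem : ∀ s ∈ A, ∀ r, σ.Served r q s → r.1 ∈ S.jobInsts i k := fun s hs r hr => by
    obtain ⟨y, hyJ, hy⟩ := hA s hs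
    rwa [Option.some_inj.1 (hr.1.symm.trans hy)]
  refine h.volume_le_of_served_unique (q := q) (fun s hs => ?_) ?_
  · obtain ⟨y, hyJ, hy⟩ := hA s hs.1
    obtain ⟨n, hn⟩ := h.exists_served hy
    refine ⟨⟨y, n⟩, hn, le_of_eq ?_⟩
    rw [(mem_jobInsts.1 hyJ).1]
  · rintro s ⟨hs, rfl⟩ s' ⟨-, hc⟩ hle r r' hr hr'
    have hsame : σ.SameSegment r.1 s s' := (h.sameSegment_iff hr.2).2 <| by
      by_contra! hdone
      exact (h.completed_lt_completed hr (hmem s hs r hr) hle hdone).ne' hc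
    have hhold := h.holder_keeps q r.1 s s' hr.1 hle hsame
    exact h.atRequest_unique (h.atRequest_of_le hr.2 hle hsame) hr'.2
      (Option.some_inj.1 (hhold.symm.trans hr'.1))

theorem measurable_blocking (i : ι) (k : ℕ) (P : Finset S.Inst) (q : ρ) :
    Measurable (σ.blocking i k P q) := by
  classical
  have hexists : ∀ {p : S.Inst → ℝ → Prop}, (∀ x, MeasurableSet {s | p x s}) →
      MeasurableSet {s | ∃ x ∈ P, p x s} := fun {p} hp => by
    rw [show {s | ∃ x ∈ P, p x s} = ⋃ x ∈ P, {s | p x s} by ext; simp]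
    exact P.measurableSet_biUnion fun x _ => hp x
  refine .ite (hexists fun x => h.measurableSet_spinning x q)
    (.ite (h.measurableSet_heldBy q i) measurable_const measurable_const)
    (.ite (hexists h.measurableSet_onProc) measurable_const ?_)
  exact measurable_card_filter _ fun x _ => h.measurableSet_spinning x q

end IsLegal

end Run

end TaskSystem

namespace TaskSystem

section Terms

variable {ι ρ : Type*} (S : TaskSystem ι ρ) (i : ι) (q : ρ)

theorem intraTerm_zero :
    S.intraTerm i q 0 =
      (∑ c ∈ Finset.range (S.N i q), min (S.m i - 1) (S.N i q - 1 - c) : ℕ) * S.L i q := by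
  rw [Finset.sum_range_reflect fun c => min (S.m i - 1) c, sum_range_min_sub_one _ (S.m_pos i)]
  simp [intraTerm]

theorem intraTerm_of_pos {x : ℕ} (hx : 0 < x) (hxN : x ≤ S.N i q) :
    S.intraTerm i q x = ((S.N i q - x) * (S.m i - 1) : ℕ) * S.L i q := by
  have hx' : (1 : ℝ) ≤ x := by exact_mod_cast hx
  rw [intraTerm, max_eq_right (by linarith)]
  push_cast [hxN, Nat.cast_sub (Nat.one_le_iff_ne_zero.2 (S.m_pos i).ne')]
  ring

theorem intraTerm_nonneg {x : ℕ} (hx : x ≤ S.N i q) : 0 ≤ S.intraTerm i q x := by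
  rcases x.eq_zero_or_pos with rfl | hpos
  · rw [intraTerm_zero]
    positivity
  · rw [intraTerm_of_pos S i q hpos hx]
    positivity

variable [Fintype ι] (x : ℕ)

theorem lowerTerm_eq :
    S.lowerTerm i q x = (S.N i q + (S.m i - 1) * x : ℕ) * S.maxLower i q := by
  rw [lowerTerm]
  push_cast [Nat.cast_sub (show 1 ≤ S.m i from S.m_pos i)]
  rfl

theorem lowerTerm_nonneg : 0 ≤ S.lowerTerm i q x := by
  rw [lowerTerm_eq]
  positivity

theorem higherTerm_nonneg (tie : TieBreak) : 0 ≤ S.higherTerm tie i q x :=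
  Finset.sum_nonneg fun _ _ => mul_nonneg (Nat.cast_nonneg _) (NNReal.coe_nonneg _)

end Terms

namespace Run.IsLegal

variable {ι ρ : Type*} {S : TaskSystem ι ρ} {σ : S.Run} (h : σ.IsLegal)
  {i : ι} {k : ℕ} {P : Finset S.Inst} {q : ρ} {A : Set ℝ}
include h

open scoped Classical in
theorem card_requests_sdiff_le (hP : P ⊆ S.jobInsts i k) :
    (σ.requests (S.jobInsts i k \ P) q).card ≤ S.N i q - (σ.requests P q).card := by
  refine Nat.le_sub_of_add_le (Eq.trans_le ?_ (h.card_requests_le (subset_refl (S.jobInsts i k)) q))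
  simp only [requests, Finset.card_sigma]
  exact Finset.sum_sdiff hP

/-- While the holder is in `P` nothing is blocked, and the remaining requests of the job block at
most `m - 1` processors each. -/
theorem lintegral_blocking_own_le_of_sequential (hP : P ⊆ S.jobInsts i k) (hseq : σ.Sequential P)
    (hA : ∀ s ∈ A, ∃ y ∈ S.jobInsts i k, σ.holder q s = some y) :
    ∫⁻ s in A, σ.blocking i k P q s ≤
      ((S.N i q - (σ.requests P q).card) * (S.m i - 1) : ℕ) * S.L i q := by
  classical
  set R := σ.requests (S.jobInsts i k \ P) q
  have hsplit : A ⊆ {s | s ∈ A ∧ ∃ y ∈ P, σ.holder q s = some y} ∪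
      {s | s ∈ A ∧ ∃ y ∈ S.jobInsts i k \ P, σ.holder q s = some y} := fun s hs => by
    obtain ⟨y, hyJ, hy⟩ := hA s hs
    by_cases hyP : y ∈ P
    exacts [.inl ⟨hs, y, hyP, hy⟩, .inr ⟨hs, y, Finset.mem_sdiff.2 ⟨hyJ, hyP⟩, hy⟩]
  have hinside : ∫⁻ s in {s | s ∈ A ∧ ∃ y ∈ P, σ.holder q s = some y},
      (σ.blocking i k P q s : ENNReal) ≤ (0 : ℕ) * ⊤ :=
    setLIntegral_natCast_le (fun s ⟨_, y, hyP, hy⟩ => (blocking_eq_zero_of_holder_mem hseq hyP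
      (h.holder_access q y s hy).1 hy).le) le_top
  have hvol : volume {s | s ∈ A ∧ ∃ y ∈ S.jobInsts i k \ P, σ.holder q s = some y} ≤
      R.card * S.L i q := by
    refine (h.volume_le_sum_of_forall_exists_served (R := R) (q := q) ?_).trans_eq ?_
    · rintro s ⟨-, y, hy, hhold⟩
      obtain ⟨n, hn⟩ := h.exists_served hhold
      exact ⟨⟨y, n⟩, mem_requests.2 ⟨hy, hn.2.1⟩, hn⟩
    · rw [Finset.sum_congr rfl fun r hr => by rw [(mem_jobInsts.1
        (Finset.mem_sdiff.1 (mem_requests.1 hr).1).1).1], Finset.sum_const, nsmul_eq_mul]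
  have houtside : ∫⁻ s in {s | s ∈ A ∧ ∃ y ∈ S.jobInsts i k \ P, σ.holder q s = some y},
      (σ.blocking i k P q s : ENNReal) ≤ (S.m i - 1 : ℕ) * (R.card * S.L i q) :=
    setLIntegral_natCast_le (fun s ⟨_, y, hy, hhold⟩ => h.blocking_le_sub_one_of_heldBy
      ⟨y, hhold, (mem_jobInsts.1 (Finset.mem_sdiff.1 hy).1).1⟩) hvol
  calc ∫⁻ s in A, (σ.blocking i k P q s : ENNReal)
      ≤ (0 : ℕ) * ⊤ + (S.m i - 1 : ℕ) * (R.card * S.L i q) :=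
        ((lintegral_mono_set hsplit).trans (lintegral_union_le _ _ _)).trans
          (add_le_add hinside houtside)
    _ = (R.card * (S.m i - 1) : ℕ) * S.L i q := by push_cast; ring
    _ ≤ _ := by gcongr; exact h.card_requests_sdiff_le hP

/-- While the job performs its access number `c + 1`, at most `N - 1 - c` others are waiting. -/
theorem lintegral_blocking_own_le_of_requests_eq_empty (hP : P ⊆ S.jobInsts i k)
    (hempty : σ.requests P q = ∅)
    (hA : ∀ s ∈ A, ∃ y ∈ S.jobInsts i k, σ.holder q s = some y) :
    ∫⁻ s in A, σ.blocking i k P q s ≤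
      (∑ c ∈ Finset.range (S.N i q), min (S.m i - 1) (S.N i q - 1 - c) : ℕ) * S.L i q := by
  have hlt : ∀ s ∈ A, σ.blocking i k P q s + σ.completed i k q s < S.N i q := fun s hs => by
    obtain ⟨y, hyJ, hy⟩ := hA s hs
    exact h.blocking_add_completed_lt hP hempty hyJ hy
  have hcover : A ⊆ ⋃ c ∈ Finset.range (S.N i q), {s | s ∈ A ∧ σ.completed i k q s = c} :=
    fun s hs => Set.mem_biUnion
      (Finset.mem_coe.2 (Finset.mem_range.2 ((Nat.le_add_left _ _).trans_lt (hlt s hs)))) ⟨hs, rfl⟩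
  refine (setLIntegral_le_sum_of_subset_biUnion hcover _).trans ?_
  rw [Nat.cast_sum, Finset.sum_mul]
  refine Finset.sum_le_sum fun c _ => ?_
  refine setLIntegral_natCast_le (fun s ⟨hs, hc⟩ => le_min ?_ ?_) (h.volume_completed_eq_le hA c)
  · obtain ⟨y, hyJ, hy⟩ := hA s hs
    exact h.blocking_le_sub_one_of_heldBy ⟨y, hy, (mem_jobInsts.1 hyJ).1⟩
  · have := hlt s hs
    omega

theorem lintegral_blocking_own_le (hP : P ⊆ S.jobInsts i k) (hseq : σ.Sequential P)
    (hA : ∀ s ∈ A, ∃ y ∈ S.jobInsts i k, σ.holder q s = some y) :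
    ∫⁻ s in A, σ.blocking i k P q s ≤
      ENNReal.ofReal (S.intraTerm i q (σ.requests P q).card) := by
  rcases Finset.eq_empty_or_nonempty (σ.requests P q) with hempty | hne
  · rw [hempty, Finset.card_empty, intraTerm_zero, ofReal_natCast_mul_coe]
    exact h.lintegral_blocking_own_le_of_requests_eq_empty hP hempty hA
  · rw [intraTerm_of_pos S i q hne.card_pos (h.card_requests_le hP q), ofReal_natCast_mul_coe]
    exact h.lintegral_blocking_own_le_of_sequential hP hseq hA

theorem lintegral_blocking_le_of_waiting (hP : P ⊆ S.jobInsts i k) {b : ENNReal}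
    (hb : ∀ r : S.Request, r.1.1 = i → r.1.2.1 = k →
      volume {s | s ∈ A ∧ σ.Waiting r q s} ≤ b) :
    ∫⁻ s in A, σ.blocking i k P q s ≤
      (S.N i q + (S.m i - 1) * (σ.requests P q).card : ℕ) * b := by
  classical
  have hwaiting : ∀ X ⊆ S.jobInsts i k,
      ∫⁻ s in A, ((σ.requests X q).filter fun r => σ.Waiting r q s).card ≤
        (σ.requests X q).card * b := fun X hX => by
    rw [setLIntegral_card_filter _ fun r _ => h.measurableSet_waiting r q, ← nsmul_eq_mul]
    refine Finset.sum_le_card_nsmul _ _ _ fun r hr => ?_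
    obtain ⟨hi, hk⟩ := mem_jobInsts.1 (hX (mem_requests.1 hr).1)
    exact hb r hi hk
  have hmeas : ∀ X, Measurable fun s =>
      (((σ.requests X q).filter fun r => σ.Waiting r q s).card : ENNReal) := fun X =>
    measurable_from_nat.comp (measurable_card_filter _ fun r _ => h.measurableSet_waiting r q)
  calc ∫⁻ s in A, (σ.blocking i k P q s : ENNReal)
      ≤ ∫⁻ s in A, ((S.m i - 1 : ℕ) *
          (((σ.requests P q).filter fun r => σ.Waiting r q s).card : ENNReal) +
          ((σ.requests (S.jobInsts i k) q).filter fun r => σ.Waiting r q s).card) :=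
        lintegral_mono fun s => by
          beta_reduce
          exact_mod_cast h.blocking_le_card_waiting hP
    _ ≤ (S.m i - 1 : ℕ) * ((σ.requests P q).card * b) + S.N i q * b := by
        rw [lintegral_add_left ((hmeas P).const_mul _), lintegral_const_mul _ (hmeas P)]
        gcongr
        · exact hwaiting P hP
        · refine (hwaiting _ subset_rfl).trans ?_
          gcongr
          exact h.card_requests_le subset_rfl q
    _ = _ := by push_cast; ring

theorem lintegral_blocking_lower_le [Fintype ι] (hprio : σ.PriorityOrdered)
    (hP : P ⊆ S.jobInsts i k) :
    ∫⁻ s in {s | s ∈ A ∧ ∃ j ∈ S.lower i, σ.HeldBy q j s}, σ.blocking i k P q s ≤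
      ENNReal.ofReal (S.lowerTerm i q (σ.requests P q).card) := by
  rw [lowerTerm_eq, ofReal_natCast_mul_coe]
  refine h.lintegral_blocking_le_of_waiting hP ?_
  rintro r rfl -
  refine (measure_mono ?_).trans
    (h.volume_heldBy_lower_le hprio (A := {s | σ.Waiting r q s}) fun s hs => hs)
  exact fun s ⟨⟨_, hlow⟩, hs⟩ => ⟨hs, hlow⟩

section Higher

variable {t : ℝ} (hmet : σ.MeetsDeadlinesBefore t) (ht : t ≤ σ.deadline i k)
  (hN : 0 < S.N i q) (j : ι)
include hmet ht hN

theorem lintegral_blocking_heldBy_le_eta :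
    ∫⁻ s in {s | s ∈ Set.Ico (σ.release i k) t ∧ σ.HeldBy q j s}, σ.blocking i k P q s ≤
      (S.m i * S.eta i j q * S.N j q : ℕ) * S.L j q := by
  refine (setLIntegral_natCast_le (fun _ _ => blocking_le)
    (h.volume_heldBy_pending_le hmet ht q j)).trans_eq ?_
  rcases Nat.eq_zero_or_pos (S.N j q) with hNj | hNj
  · simp [hNj]
  · rw [eta, if_pos ⟨hN, hNj⟩]
    push_cast
    ring

variable [Fintype ι] (hprio : σ.PriorityOrdered) {tie : TieBreak} (htie : σ.RespectsTies tie)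
  (hP : P ⊆ S.jobInsts i k)
include hprio htie hP

theorem lintegral_blocking_heldBy_le_jobsPerRequest {n : ℕ}
    (hn : S.jobsPerRequest tie i j q = n) :
    ∫⁻ s in {s | s ∈ Set.Ico (σ.release i k) t ∧ σ.HeldBy q j s}, σ.blocking i k P q s ≤
      ((S.N i q + (S.m i - 1) * (σ.requests P q).card) * n * S.N j q : ℕ) * S.L j q := by
  have hcast : (((S.N i q + (S.m i - 1) * (σ.requests P q).card) * n * S.N j q : ℕ) : ENNReal) *
      S.L j q = (S.N i q + (S.m i - 1) * (σ.requests P q).card : ℕ) *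
        ((n * S.N j q * S.L j q : NNReal) : ENNReal) := by
    push_cast
    ring
  rw [hcast]
  refine h.lintegral_blocking_le_of_waiting hP ?_
  rintro r rfl rfl
  rcases Nat.eq_zero_or_pos (S.N j q) with hNj | hNj
  · refine (measure_mono fun s hs => hs.1).trans
      ((h.volume_heldBy_pending_le hmet ht q j).trans_eq ?_)
    simp [hNj]
  rw [jobsPerRequest, if_pos ⟨hN, hNj⟩] at hn
  split_ifs at hn with hd
  · rw [← Nat.cast_inj.1 hn]
    refine (measure_mono ?_).trans (h.volume_heldBy_le_of_waiting hprio htie hmet ht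
      (A := {s | s ∈ Set.Ico (σ.release r.1.1 r.1.2.1) t ∧ σ.Waiting r q s})
      (fun s hs => hs.1.2) (fun s hs => hs.2) hd j)
    exact fun s ⟨⟨hs, hj⟩, hw⟩ => ⟨⟨hs, hw⟩, hj⟩
  · exact absurd hn (ENat.top_ne_natCast n)

theorem lintegral_blocking_heldBy_le :
    ∫⁻ s in {s | s ∈ Set.Ico (σ.release i k) t ∧ σ.HeldBy q j s}, σ.blocking i k P q s ≤
      (min ((S.m i * S.eta i j q * S.N j q : ℕ) : ℕ∞)
        (((S.N i q + (S.m i - 1) * (σ.requests P q).card : ℕ) : ℕ∞) *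
          S.jobsPerRequest tie i j q * S.N j q)).toNat * S.L j q := by
  cases hn : S.jobsPerRequest tie i j q with
  | top =>
    have hNj : S.N j q ≠ 0 := fun hNj => by simp [jobsPerRequest, hNj] at hn
    have hrequests : S.N i q + (S.m i - 1) * (σ.requests P q).card ≠ 0 := by omega
    rw [ENat.mul_top (by exact_mod_cast hrequests), ENat.top_mul (by exact_mod_cast hNj),
      min_eq_left le_top, ENat.toNat_natCast]
    exact h.lintegral_blocking_heldBy_le_eta hmet ht hN j
  | coe n =>
    rw [← Nat.cast_mul, ← Nat.cast_mul]
    rcases min_choice ((S.m i * S.eta i j q * S.N j q : ℕ) : ℕ∞)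
      ((S.N i q + (S.m i - 1) * (σ.requests P q).card) * n * S.N j q : ℕ) with heq | heq
    · rw [heq, ENat.toNat_natCast]
      exact h.lintegral_blocking_heldBy_le_eta hmet ht hN j
    · rw [heq, ENat.toNat_natCast]
      exact h.lintegral_blocking_heldBy_le_jobsPerRequest hmet ht hN j hprio htie hP hn

theorem lintegral_blocking_le (hseq : σ.Sequential P) :
    ∫⁻ s in Set.Ico (σ.release i k) t, σ.blocking i k P q s ≤
      ENNReal.ofReal (S.intraTerm i q (σ.requests P q).card +
        (S.lowerTerm i q (σ.requests P q).card + S.higherTerm tie i q (σ.requests P q).card)) := by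
  set W := Set.Ico (σ.release i k) t
  set x := (σ.requests P q).card
  have hcover : W ⊆ {s | σ.holder q s = none} ∪ ({s | s ∈ W ∧ σ.HeldBy q i s} ∪
      ({s | s ∈ W ∧ ∃ j ∈ S.lower i, σ.HeldBy q j s} ∪
        ⋃ j ∈ S.higher i, {s | s ∈ W ∧ σ.HeldBy q j s})) := fun s hs => by
    by_cases hq : σ.holder q s = none
    · exact .inl hq
    rcases heldBy_lower_or_own_or_higher i hq with hlow | hown | ⟨j, hj, hhigh⟩
    · exact .inr (.inr (.inl ⟨hs, hlow⟩))
    · exact .inr (.inl ⟨hs, hown⟩)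
    · exact .inr (.inr (.inr (Set.mem_biUnion hj ⟨hs, hhigh⟩)))
  have hfree : ∫⁻ s in {s | σ.holder q s = none}, (σ.blocking i k P q s : ENNReal) ≤
      (0 : ℕ) * ⊤ :=
    setLIntegral_natCast_le (fun s hs => (h.blocking_eq_zero_of_holder_eq_none hs).le) le_top
  have hown : ∫⁻ s in {s | s ∈ W ∧ σ.HeldBy q i s}, (σ.blocking i k P q s : ENNReal) ≤
      ENNReal.ofReal (S.intraTerm i q x) :=
    h.lintegral_blocking_own_le hP hseq fun s ⟨hs, y, hy, hyi⟩ =>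
      ⟨y, h.mem_jobInsts_of_onProc hmet ht hs (h.holder_access q y s hy).1 hyi, hy⟩
  have hhigher : ∫⁻ s in ⋃ j ∈ S.higher i, {s | s ∈ W ∧ σ.HeldBy q j s},
      (σ.blocking i k P q s : ENNReal) ≤ ENNReal.ofReal (S.higherTerm tie i q x) := by
    refine (setLIntegral_le_sum_of_subset_biUnion subset_rfl _).trans ?_
    rw [higherTerm, ENNReal.ofReal_sum_of_nonneg fun j _ => by positivity]
    refine Finset.sum_le_sum fun j _ => ?_
    rw [ofReal_natCast_mul_coe]
    exact h.lintegral_blocking_heldBy_le hmet ht hN j hprio htie hP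
  rw [ENNReal.ofReal_add (S.intraTerm_nonneg i q (x := x) (h.card_requests_le hP q))
    (add_nonneg (S.lowerTerm_nonneg i q x) (S.higherTerm_nonneg i q x tie)),
    ENNReal.ofReal_add (S.lowerTerm_nonneg i q x) (S.higherTerm_nonneg i q x tie)]
  calc ∫⁻ s in W, (σ.blocking i k P q s : ENNReal)
      ≤ (0 : ℕ) * ⊤ + (ENNReal.ofReal (S.intraTerm i q x) +
          (ENNReal.ofReal (S.lowerTerm i q x) + ENNReal.ofReal (S.higherTerm tie i q x))) :=
        (lintegral_mono_set hcover).trans <| (lintegral_union_le _ _ _).trans <|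
          add_le_add hfree <| (lintegral_union_le _ _ _).trans <| add_le_add hown <|
          (lintegral_union_le _ _ _).trans <|
          add_le_add (h.lintegral_blocking_lower_le hprio hP) hhigher
    _ = _ := by simp

end Higher

end Run.IsLegal

end TaskSystem

/-! ### The key path -/

namespace TaskSystem

section Path

variable {ι ρ : Type*} {S : TaskSystem ι ρ} {i : ι} {π : List (S.V i)} (hπ : π.IsChain (S.E i))
include hπ

theorem pairwise_transGen_of_isChain : π.Pairwise (Relation.TransGen (S.E i)) :=
  List.isChain_iff_pairwise.1 (hπ.imp fun _ _ => .single)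

theorem nodup_of_isChain : π.Nodup := by
  refine (pairwise_transGen_of_isChain hπ).imp ?_
  rintro v _ hvw rfl
  exact S.acyclic i v hvw

theorem sum_le_longestPath : (π.map fun v => (S.c i v : ℝ)).sum ≤ S.longestPath i := by
  classical
  refine le_csSup ⟨S.totalWCET i, ?_⟩ ⟨π, hπ, rfl⟩
  rintro _ ⟨π', hπ', rfl⟩
  rw [← List.sum_toFinset _ (nodup_of_isChain hπ'), totalWCET]
  exact Finset.sum_le_sum_of_subset_of_nonneg (Finset.subset_univ _) fun v _ _ => (S.c i v).2

end Path

namespace Run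

variable {ι ρ : Type*} {S : TaskSystem ι ρ} {σ : S.Run} {i : ι} {k : ℕ} {t : ℝ}

theorem jobFinished_iff : σ.JobFinished i k t ↔ σ.release i k ≤ t ∧
    ∀ v, Segment.total (σ.prog ⟨i, (k, v)⟩) ≤ σ.work ⟨i, (k, v)⟩ t :=
  ⟨fun hfin => ⟨hfin.1, fun v => (hfin.2 v).2 v .refl⟩,
    fun ⟨hrel, hwork⟩ => ⟨hrel, fun _ => ⟨hrel, fun u _ => hwork u⟩⟩⟩

namespace IsLegal

variable (h : σ.IsLegal)
include h

theorem work_le_total (x : S.Inst) (t : ℝ) : σ.work x t ≤ Segment.total (σ.prog x) := by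
  have htotal : 0 ≤ Segment.total (σ.prog x) := List.sum_nonneg fun a ha => by
    obtain ⟨s, hs, rfl⟩ := List.mem_map.1 ha
    exact (h.len_pos x s hs).le
  have hvol := h.volume_executing_work_mem_Icc_le x 0 (Segment.total (σ.prog x))
  rw [sub_zero] at hvol
  rw [h.work_eq]
  refine ENNReal.toReal_le_of_le_ofReal htotal ((measure_mono ?_).trans hvol)
  exact fun s ⟨_, hs⟩ => ⟨hs, h.work_nonneg x s, (h.eligible_and_work_lt hs.1).2.le⟩

theorem finished_mono {v : S.V i} {t' : ℝ} (ht : t ≤ t') (hv : σ.Finished i k v t) :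
    σ.Finished i k v t' :=
  ⟨hv.1.trans ht, fun u hu => (hv.2 u hu).trans (h.work_mono _ ht)⟩

/-- Precede a vertex by its predecessor that finishes last, and repeat. -/
theorem exists_keyPath (k : ℕ) (v : S.V i) :
    ∃ π : List (S.V i), π.IsChain (S.E i) ∧ π.getLast? = some v ∧
      ∀ s, σ.release i k ≤ s → ¬ σ.Finished i k v s →
        ∃ w ∈ π, σ.Eligible i k w s ∧ ¬ σ.Finished i k w s := by
  have : Std.Irrefl (Relation.TransGen (S.E i)) := ⟨S.acyclic i⟩
  induction v using (Finite.wellFounded_of_trans_of_irrefl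
    (Relation.TransGen (S.E i))).induction with
  | _ v ih =>
    by_cases hv : ∃ u, S.E i u v
    · obtain ⟨u, hu, hmax⟩ := Set.Finite.exists_maximalFor
        (fun u => {s | ¬ σ.Finished i k u s}) {u | S.E i u v} (Set.toFinite _) hv
      have hlast : ∀ u', S.E i u' v → ∀ s, σ.Finished i k u s → σ.Finished i k u' s := by
        have hlower : ∀ w, IsLowerSet {s | ¬ σ.Finished i k w s} := fun w _ _ hle hs hfin =>
          hs (h.finished_mono hle hfin)
        intro u' hu' s hs
        by_contra hs'
        exact ((hlower u').total (hlower u)).elim (fun hsub => hsub hs' hs)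
          fun hsub => hmax hu' hsub hs' hs
      obtain ⟨π, hπ, hπu, hkey⟩ := ih u (.single hu)
      refine ⟨π ++ [v], List.isChain_append.2 ⟨hπ, .singleton v, ?_⟩, by simp, ?_⟩
      · simpa [hπu] using hu
      · intro s hrel hs
        by_cases hfin : σ.Finished i k u s
        · exact ⟨v, by simp, ⟨hrel, fun u' hu' => hlast u' hu' s hfin⟩, hs⟩
        · obtain ⟨w, hw, hws⟩ := hkey s hrel hfin
          exact ⟨w, List.mem_append_left _ hw, hws⟩
    · exact ⟨[v], .singleton v, rfl, fun s hrel hs =>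
        ⟨v, by simp, ⟨hrel, fun u hu => absurd ⟨u, hu⟩ hv⟩, hs⟩⟩

theorem not_transGen_of_onProc {v w : S.V i} {s : ℝ} (hv : σ.OnProc ⟨i, (k, v)⟩ s)
    (hw : σ.OnProc ⟨i, (k, w)⟩ s) : ¬ Relation.TransGen (S.E i) v w := by
  intro hvw
  obtain ⟨u, hu, huw⟩ := Relation.TransGen.tail'_iff.1 hvw
  exact (((h.eligible_and_work_lt hw).1.2 u huw).2 v hu).not_gt (h.eligible_and_work_lt hv).2

theorem eq_of_onProc_of_isChain {π : List (S.V i)} (hπ : π.IsChain (S.E i)) {v w : S.V i}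
    (hv : v ∈ π) (hw : w ∈ π) {s : ℝ} (hvs : σ.OnProc ⟨i, (k, v)⟩ s)
    (hws : σ.OnProc ⟨i, (k, w)⟩ s) : v = w := by
  by_contra hne
  let comparable : S.V i → S.V i → Prop := fun a b =>
    Relation.TransGen (S.E i) a b ∨ Relation.TransGen (S.E i) b a
  have : Std.Symm comparable := ⟨fun _ _ => Or.symm⟩
  have hcomparable : π.Pairwise comparable := (pairwise_transGen_of_isChain hπ).imp .inl
  exact (hcomparable.forall hv hw hne).elim (h.not_transGen_of_onProc hvs hws)
    (h.not_transGen_of_onProc hws hvs)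

theorem exists_keyPath_insts (hrel : σ.release i k ≤ t) (hnf : ¬ σ.JobFinished i k t) :
    ∃ P ⊆ S.jobInsts i k, σ.Sequential P ∧ ∑ x ∈ P, σ.work x t ≤ S.longestPath i ∧
      ∀ s ∈ Set.Ico (σ.release i k) t, ∃ w, ⟨i, (k, w)⟩ ∈ P ∧
        σ.Eligible i k w s ∧ ¬ σ.Finished i k w s := by
  classical
  obtain ⟨v, hv⟩ : ∃ v, ¬ σ.Finished i k v t := by
    by_contra! hall
    exact hnf ⟨hrel, hall⟩
  obtain ⟨π, hπ, -, hkey⟩ := h.exists_keyPath k v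
  have hmem : ∀ {x : S.Inst}, x ∈ π.toFinset.image (fun w => (⟨i, (k, w)⟩ : S.Inst)) ↔
      ∃ w ∈ π, ⟨i, (k, w)⟩ = x := by simp
  refine ⟨π.toFinset.image fun w => ⟨i, (k, w)⟩, fun x hx => ?_, ?_, ?_, fun s hs => ?_⟩
  · obtain ⟨w, -, rfl⟩ := hmem.1 hx
    exact mem_jobInsts.2 ⟨rfl, rfl⟩
  · rintro s x ⟨hx, hxs⟩ y ⟨hy, hys⟩
    obtain ⟨w, hw, rfl⟩ := hmem.1 hx
    obtain ⟨w', hw', rfl⟩ := hmem.1 hy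
    rw [h.eq_of_onProc_of_isChain hπ hw hw' hxs hys]
  · rw [Finset.sum_image fun w _ w' _ heq => by simpa using heq]
    refine le_trans ?_ (sum_le_longestPath hπ)
    rw [← List.sum_toFinset _ (nodup_of_isChain hπ)]
    exact Finset.sum_le_sum fun w _ => (h.work_le_total _ t).trans (h.wcet i k w)
  · obtain ⟨w, hw, hws⟩ := hkey s hs.1 fun hfin => hv (h.finished_mono hs.2.le hfin)
    exact ⟨w, hmem.2 ⟨w, hw, rfl⟩, hws⟩

end IsLegal

end Run

end TaskSystem

/-! ### Response times -/

namespace TaskSystem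

variable {ι ρ : Type*} {S : TaskSystem ι ρ}

theorem one_le_m (S : TaskSystem ι ρ) (i : ι) : (1 : ℝ) ≤ S.m i := by
  exact_mod_cast S.m_pos i

namespace Run

variable {σ : S.Run} {i : ι} {k : ℕ} {t : ℝ}

namespace IsLegal

variable (h : σ.IsLegal)
include h

theorem mem_resources_of_spinning [Fintype ρ] {x : S.Inst} {q : ρ} {s : ℝ}
    (hx : σ.Spinning x q s) : q ∈ S.resources x.1 := by
  obtain ⟨n, hn⟩ := h.exists_waiting hx
  have hmem : ⟨x, n⟩ ∈ σ.requests (S.jobInsts x.1 x.2.1) q :=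
    mem_requests.2 ⟨mem_jobInsts.2 ⟨rfl, rfl⟩, hn.2.1⟩
  simpa only [resources, Finset.mem_filter, Finset.mem_univ, true_and] using
    (Finset.card_pos.2 ⟨_, hmem⟩).trans_le (h.card_requests_le subset_rfl q)

open scoped Classical in
theorem card_onProc_le_executing_add_spinning [Fintype ρ] (i : ι) (k : ℕ) (s : ℝ) :
    ((S.jobInsts i k).filter fun x => σ.OnProc x s).card ≤
      ((S.jobInsts i k).filter fun x => σ.Executing x s).card +
        ∑ q ∈ S.resources i, ((S.jobInsts i k).filter fun x => σ.Spinning x q s).card := by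
  refine (Finset.card_le_card fun x hx => ?_).trans ((Finset.card_union_le _ _).trans
    (Nat.add_le_add_left Finset.card_biUnion_le _))
  obtain ⟨hxJ, hon⟩ := Finset.mem_filter.1 hx
  by_cases hspin : ∃ q, σ.Spinning x q s
  · obtain ⟨q, hq⟩ := hspin
    have hres : q ∈ S.resources i := (mem_jobInsts.1 hxJ).1 ▸ h.mem_resources_of_spinning hq
    exact Finset.mem_union_right _
      (Finset.mem_biUnion.2 ⟨q, hres, Finset.mem_filter.2 ⟨hxJ, hq⟩⟩)
  · exact Finset.mem_union_left _
      (Finset.mem_filter.2 ⟨hxJ, hon, fun q hq => hspin ⟨q, hq⟩⟩)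

section Pending

variable (hmet : σ.MeetsDeadlinesBefore t) (ht : t ≤ σ.deadline i k) {s : ℝ}
  (hs : s ∈ Set.Ico (σ.release i k) t)
include hmet ht hs

open scoped Classical in
theorem m_le_card_onProc {w : S.V i} (hel : σ.Eligible i k w s) (hnf : ¬ σ.Finished i k w s)
    (hoff : ¬ σ.OnProc ⟨i, (k, w)⟩ s) :
    S.m i ≤ ((S.jobInsts i k).filter fun x => σ.OnProc x s).card := by
  choose y hy using fun p =>
    Option.ne_none_iff_exists'.1 (h.work_conserving i k w s hel hnf hoff p)
  have hmem : ∀ p, (⟨i, y p⟩ : S.Inst) ∈ (S.jobInsts i k).filter fun x => σ.OnProc x s := fun p =>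
    Finset.mem_filter.2 ⟨h.mem_jobInsts_of_onProc hmet ht hs ⟨p, hy p⟩ rfl, p, hy p⟩
  have hinj : Function.Injective fun p => (⟨i, y p⟩ : S.Inst) := fun p p' heq =>
    h.sched_injective i p p' (y p) s (hy p) (by rw [hy p', eq_of_heq (Sigma.mk.inj heq).2])
  simpa using Finset.card_le_card_of_injOn (s := Finset.univ) _ (fun p _ => hmem p) hinj.injOn

variable [Fintype ρ] {P : Finset S.Inst} (hP : P ⊆ S.jobInsts i k)
include hP

open scoped Classical in
theorem m_le_executing_add_blocking
    (hkey : ∃ w, ⟨i, (k, w)⟩ ∈ P ∧ σ.Eligible i k w s ∧ ¬ σ.Finished i k w s) :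
    S.m i ≤ ((S.jobInsts i k).filter fun x => σ.Executing x s).card +
      ((S.m i - 1) * (P.filter fun x => σ.Executing x s).card +
        ∑ q ∈ S.resources i, σ.blocking i k P q s) := by
  have hpos : ∀ {X : Finset S.Inst} {x : S.Inst}, x ∈ X → σ.Executing x s →
      1 ≤ (X.filter fun x => σ.Executing x s).card := fun hxX hx =>
    Finset.card_pos.2 ⟨_, Finset.mem_filter.2 ⟨hxX, hx⟩⟩
  by_cases hon : ∃ x ∈ P, σ.OnProc x s
  · obtain ⟨x, hxP, hon⟩ := hon
    by_cases hspin : ∃ q, σ.Spinning x q s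
    · obtain ⟨q, hq⟩ := hspin
      have hres : q ∈ S.resources i := (mem_jobInsts.1 (hP hxP)).1 ▸ h.mem_resources_of_spinning hq
      have hle : σ.blocking i k P q s ≤ ∑ q ∈ S.resources i, σ.blocking i k P q s :=
        Finset.single_le_sum (f := fun q => σ.blocking i k P q s) (fun _ _ => Nat.zero_le _) hres
      rw [blocking, if_pos ⟨x, hxP, hq⟩] at hle
      split_ifs at hle with hheld
      · obtain ⟨y, hy, hyi⟩ := hheld
        have hyJ := h.mem_jobInsts_of_onProc hmet ht hs (h.holder_access q y s hy).1 hyi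
        have := hpos hyJ (h.executing_of_holder hy)
        omega
      · omega
    · have hex : σ.Executing x s := ⟨hon, fun q hq => hspin ⟨q, hq⟩⟩
      have hJ := hpos (hP hxP) hex
      have hmul := Nat.mul_le_mul_left (S.m i - 1) (hpos hxP hex)
      omega
  · obtain ⟨w, hwP, hel, hnf⟩ := hkey
    have hspin : ∀ q, ¬ ∃ x ∈ P, σ.Spinning x q s := fun q ⟨x, hxP, hx⟩ => hon ⟨x, hxP, hx.1⟩
    have hfull := h.m_le_card_onProc hmet ht hs hel hnf fun hw => hon ⟨_, hwP, hw⟩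
    have hsplit := h.card_onProc_le_executing_add_spinning i k s
    simp only [blocking, if_neg (hspin _), if_neg hon]
    omega

end Pending

open scoped Classical in
theorem setLIntegral_card_executing [Countable ρ] {X : Finset S.Inst} (hX : X ⊆ S.jobInsts i k)
    (hrel : σ.release i k ≤ t) :
    ∫⁻ s in Set.Ico (σ.release i k) t, (X.filter fun x => σ.Executing x s).card =
      ENNReal.ofReal (∑ x ∈ X, σ.work x t) := by
  rw [setLIntegral_card_filter X (fun x _ => h.measurableSet_executing x),
    ENNReal.ofReal_sum_of_nonneg fun x _ => h.work_nonneg x t]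
  refine Finset.sum_congr rfl fun x hx => ?_
  have hzero : σ.work x (σ.release i k) = 0 := by
    obtain ⟨rfl, rfl⟩ := mem_jobInsts.1 (hX hx)
    exact h.work_eq_zero_of_le_release le_rfl
  rw [h.work_eq_add hrel, hzero, zero_add, ofReal_measureReal (h := ?_)]
  exact measure_ne_top_of_subset (fun s hs => hs.1) measure_Ico_lt_top.ne

section Pending

variable (hmet : σ.MeetsDeadlinesBefore t) (ht : t ≤ σ.deadline i k)
  (hrel : σ.release i k ≤ t)
include hmet ht hrel

theorem m_mul_ofReal_sub_le [Fintype ρ] {P : Finset S.Inst} (hP : P ⊆ S.jobInsts i k)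
    (hkey : ∀ s ∈ Set.Ico (σ.release i k) t, ∃ w, ⟨i, (k, w)⟩ ∈ P ∧
      σ.Eligible i k w s ∧ ¬ σ.Finished i k w s) :
    S.m i * ENNReal.ofReal (t - σ.release i k) ≤
      ENNReal.ofReal (∑ x ∈ S.jobInsts i k, σ.work x t) +
        ((S.m i - 1 : ℕ) * ENNReal.ofReal (∑ x ∈ P, σ.work x t) +
          ∑ q ∈ S.resources i, ∫⁻ s in Set.Ico (σ.release i k) t, σ.blocking i k P q s) := by
  classical
  have hexec : ∀ X : Finset S.Inst,
      Measurable fun s => ((X.filter fun x => σ.Executing x s).card : ENNReal) := fun X =>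
    measurable_from_top.comp (measurable_card_filter X fun x _ => h.measurableSet_executing x)
  have hblock : ∀ q ∈ S.resources i, Measurable fun s => (σ.blocking i k P q s : ENNReal) :=
    fun q _ => measurable_from_top.comp (h.measurable_blocking i k P q)
  calc S.m i * ENNReal.ofReal (t - σ.release i k)
      = ∫⁻ _ in Set.Ico (σ.release i k) t, S.m i := by
        rw [setLIntegral_const, Real.volume_Ico]
    _ ≤ ∫⁻ s in Set.Ico (σ.release i k) t,
          (((S.jobInsts i k).filter fun x => σ.Executing x s).card +
            ((S.m i - 1 : ℕ) * (P.filter fun x => σ.Executing x s).card +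
              ∑ q ∈ S.resources i, (σ.blocking i k P q s : ENNReal))) :=
        setLIntegral_mono' measurableSet_Ico fun s hs => by
          exact_mod_cast h.m_le_executing_add_blocking hmet ht hs hP (hkey s hs)
    _ = _ := by
        rw [lintegral_add_left (hexec _), lintegral_add_left ((hexec P).const_mul _),
          lintegral_const_mul _ (hexec P), lintegral_finsetSum _ hblock,
          h.setLIntegral_card_executing subset_rfl hrel, h.setLIntegral_card_executing hP hrel]

variable [Fintype ι] [Fintype ρ] {tie : TieBreak} (hprio : σ.PriorityOrdered)
  (htie : σ.RespectsTies tie)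
include hprio htie

theorem m_mul_sub_le {P : Finset S.Inst} (hP : P ⊆ S.jobInsts i k) (hseq : σ.Sequential P)
    (hkey : ∀ s ∈ Set.Ico (σ.release i k) t, ∃ w, ⟨i, (k, w)⟩ ∈ P ∧
      σ.Eligible i k w s ∧ ¬ σ.Finished i k w s) :
    S.m i * (t - σ.release i k) ≤ ∑ x ∈ S.jobInsts i k, σ.work x t +
      (((S.m i - 1 : ℕ) : ℝ) * ∑ x ∈ P, σ.work x t +
        ∑ q ∈ S.resources i, (S.intraTerm i q (σ.requests P q).card +
          (S.lowerTerm i q (σ.requests P q).card +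
            S.higherTerm tie i q (σ.requests P q).card))) := by
  have hwork : ∀ X : Finset S.Inst, 0 ≤ ∑ x ∈ X, σ.work x t := fun X =>
    Finset.sum_nonneg fun x _ => h.work_nonneg x t
  have hpath := mul_nonneg (Nat.cast_nonneg (S.m i - 1)) (hwork P)
  have hterm : ∀ q ∈ S.resources i, 0 ≤ S.intraTerm i q (σ.requests P q).card +
      (S.lowerTerm i q (σ.requests P q).card + S.higherTerm tie i q (σ.requests P q).card) :=
    fun q _ => add_nonneg (intraTerm_nonneg S i q (h.card_requests_le hP q))
      (add_nonneg (lowerTerm_nonneg S i q _) (higherTerm_nonneg S i q _ tie))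
  have hsum := Finset.sum_nonneg hterm
  rw [← ENNReal.ofReal_le_ofReal_iff (add_nonneg (hwork _) (add_nonneg hpath hsum)),
    ENNReal.ofReal_add (hwork _) (add_nonneg hpath hsum), ENNReal.ofReal_add hpath hsum,
    ENNReal.ofReal_mul (Nat.cast_nonneg _), ENNReal.ofReal_mul (Nat.cast_nonneg _),
    ENNReal.ofReal_natCast, ENNReal.ofReal_natCast, ENNReal.ofReal_sum_of_nonneg hterm]
  refine (h.m_mul_ofReal_sub_le hmet ht hrel hP hkey).trans ?_
  gcongr with q hq
  exact h.lintegral_blocking_le hmet ht (Finset.mem_filter.1 hq).2 hprio htie hP hseq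

theorem sub_lt_responseBound_of_not_jobFinished (hnf : ¬ σ.JobFinished i k t) :
    t - σ.release i k < S.responseBound tie i := by
  obtain ⟨P, hP, hseq, hpath, hkey⟩ := h.exists_keyPath_insts hrel hnf
  obtain ⟨v, hv⟩ : ∃ v, σ.work ⟨i, (k, v)⟩ t < Segment.total (σ.prog ⟨i, (k, v)⟩) := by
    by_contra! hall
    exact hnf (jobFinished_iff.2 ⟨hrel, hall⟩)
  have hwork : ∑ x ∈ S.jobInsts i k, σ.work x t < S.totalWCET i := by
    rw [sum_jobInsts]
    exact Finset.sum_lt_sum (fun v _ => (h.work_le_total _ t).trans (h.wcet i k v))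
      ⟨v, Finset.mem_univ v, hv.trans_le (h.wcet i k v)⟩
  have hblock := Finset.sum_le_sum (s := S.resources i) fun q _ =>
    Finset.le_sup' (s := Finset.range (S.N i q + 1))
      (fun x => S.intraTerm i q x + (S.lowerTerm i q x + S.higherTerm tie i q x))
      (Finset.mem_range.2 (Nat.lt_succ_of_le (h.card_requests_le hP q)))
  have hm := one_le_m S i
  have hpath := mul_le_mul_of_nonneg_left hpath (sub_nonneg.2 hm)
  have hmul := h.m_mul_sub_le hmet ht hrel hprio htie hP hseq hkey
  rw [Nat.cast_pred (S.m_pos i)] at hmul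
  rw [responseBound, lt_div_iff₀ (one_pos.trans_le hm)]
  linarith

end Pending

theorem jobFinished_deadline_of_wcrt_le (hi : σ.wcrt i ≤ ENNReal.ofReal (S.D i)) (k : ℕ) :
    σ.JobFinished i k (σ.deadline i k) := by
  have hrel : σ.release i k ≤ σ.deadline i k := le_add_of_nonneg_right (S.D_pos i).le
  refine jobFinished_iff.2 ⟨hrel, fun v => le_of_forall_pos_le_add fun ε hε => ?_⟩
  have hlt : σ.responseTime i k < ENNReal.ofReal (S.D i + ε) :=
    ((le_iSup (σ.responseTime i) k).trans hi).trans_lt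
      ((ENNReal.ofReal_lt_ofReal_iff (by linarith [S.D_pos i])).2 (lt_add_of_pos_right _ hε))
  obtain ⟨t, hlt⟩ := iInf_lt_iff.1 hlt
  obtain ⟨hfin, hlt⟩ := iInf_lt_iff.1 hlt
  have ht : t ≤ σ.deadline i k + ε := by
    have := (ENNReal.ofReal_lt_ofReal_iff (by linarith [S.D_pos i])).1 hlt
    rw [deadline]
    linarith
  have hwork := h.work_le_add (x := ⟨i, (k, v)⟩)
    (le_add_of_nonneg_right hε.le : σ.deadline i k ≤ σ.deadline i k + ε)
  linarith [(jobFinished_iff.1 hfin).2 v, h.work_mono ⟨i, (k, v)⟩ ht]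

/-- If some deadline is missed, then there is an earliest one. -/
theorem jobFinished_deadline_of_forall_meetsDeadlinesBefore [Finite ι]
    (hstep : ∀ i k, σ.MeetsDeadlinesBefore (σ.deadline i k) → σ.JobFinished i k (σ.deadline i k))
    (i : ι) (k : ℕ) : σ.JobFinished i k (σ.deadline i k) := by
  have := Fintype.ofFinite ι
  have hmono : ∀ j, Monotone (σ.deadline j) := fun j => (h.release_mono j).add_const (S.D j)
  have hpwo : (⋃ j ∈ Finset.univ, σ.deadline j '' Set.univ).IsPWO :=
    (Finset.isPWO_bUnion _).2 fun j _ =>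
      (Set.isPWO_of_wellQuasiOrderedLE _).image_of_monotone (hmono j)
  have hsub : (fun p : ι × ℕ => σ.deadline p.1 p.2) ''
      {p | ¬ σ.JobFinished p.1 p.2 (σ.deadline p.1 p.2)} ⊆
        ⋃ j ∈ Finset.univ, σ.deadline j '' Set.univ := by
    rintro _ ⟨p, -, rfl⟩
    exact Set.mem_biUnion (Finset.mem_univ p.1) ⟨p.2, trivial, rfl⟩
  by_contra hmiss
  obtain ⟨⟨j, n⟩, hjn, hmin⟩ := Set.IsPWO.exists_minimalFor (fun p : ι × ℕ => σ.deadline p.1 p.2)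
    {p | ¬ σ.JobFinished p.1 p.2 (σ.deadline p.1 p.2)}
    (hpwo.mono hsub) ⟨(i, k), hmiss⟩
  refine hjn (hstep j n fun j' n' hlt => ?_)
  by_contra hlate
  exact hlt.not_ge (hmin (j := (j', n')) hlate hlt.le)

variable [Fintype ι] [Fintype ρ] {tie : TieBreak} (hprio : σ.PriorityOrdered)
  (htie : σ.RespectsTies tie)
include hprio htie

theorem jobFinished_deadline
    (hdeadline : ∀ k, σ.wcrt k ≤ ENNReal.ofReal (S.D k) ∨ S.responseBound tie k ≤ S.D k)
    (i : ι) (k : ℕ) : σ.JobFinished i k (σ.deadline i k) := by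
  refine h.jobFinished_deadline_of_forall_meetsDeadlinesBefore (fun j k hmet => ?_) i k
  refine (hdeadline j).elim (h.jobFinished_deadline_of_wcrt_le · k) fun hbound => ?_
  by_contra hnf
  have hlt := h.sub_lt_responseBound_of_not_jobFinished hmet le_rfl
    (le_add_of_nonneg_right (S.D_pos j).le) hprio htie hnf
  rw [deadline, add_sub_cancel_left] at hlt
  exact hlt.not_ge hbound

theorem responseTime_le_responseBound
    (hmet : ∀ i k, σ.JobFinished i k (σ.deadline i k)) (i : ι) (k : ℕ) :
    σ.responseTime i k ≤ ENNReal.ofReal (S.responseBound tie i) := by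
  set d := min (max (S.responseBound tie i) 0) (S.D i)
  have hd : d ≤ S.D i := min_le_right _ _
  have hfin : σ.JobFinished i k (σ.release i k + d) := by
    by_contra hnf
    have hlt := h.sub_lt_responseBound_of_not_jobFinished (fun j k _ => hmet j k)
      (add_le_add_right hd _)
      (le_add_of_nonneg_right (le_min (le_max_right _ _) (S.D_pos i).le)) hprio htie hnf
    rw [add_sub_cancel_left] at hlt
    rcases min_lt_iff.1 hlt with hlt | hlt
    · exact hlt.not_ge (le_max_left _ _)
    · have hdD : d = S.D i := min_eq_right (hlt.le.trans (le_max_left _ _))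
      exact hnf (hdD ▸ hmet i k)
  calc σ.responseTime i k ≤ ENNReal.ofReal (σ.release i k + d - σ.release i k) := iInf₂_le _ hfin
    _ ≤ ENNReal.ofReal (max (S.responseBound tie i) 0) := ENNReal.ofReal_le_ofReal (by
        rw [add_sub_cancel_left]
        exact min_le_left _ _)
    _ = ENNReal.ofReal (S.responseBound tie i) := by simp

end IsLegal

end Run

end TaskSystem

theorem mainTheorem4 {ι ρ : Type*} [Fintype ι] [Fintype ρ] (S : TaskSystem ι ρ) (tie : TieBreak)
    (σ : S.Run) (hlegal : σ.IsLegal) (hprio : σ.PriorityOrdered) (htie : σ.RespectsTies tie)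
    (hdeadline : ∀ k, σ.wcrt k ≤ ENNReal.ofReal (S.D k) ∨ S.responseBound tie k ≤ S.D k)
    (i : ι) :
    σ.wcrt i ≤ ENNReal.ofReal (S.responseBound tie i) := by
  have hmet := hlegal.jobFinished_deadline hprio htie hdeadline
  exact iSup_le (hlegal.responseTime_le_responseBound hprio htie hmet i)
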